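/- **Theorem 4.** Let $k\ge 0$, let $f_0,f_1,\dots,f_k$ be probability densities on $\mathbb R$ with finite means $0,h_1,\dots,h_k$ respectively (for instance the shifted densities $f_j=f_0(\cdot-h_j)$, where $f_0$ has mean $0$), let $\epsilon_1,\dots,\epsilon_k\ge 0$ with $\sum_j\epsilon_j<1$, and put $$f=(1-\epsilon_1-\dots-\epsilon_k)f_0+\epsilon_1f_1+\dots+\epsilon_kf_k,\qquad H=\epsilon_1h_1+\dots+\epsilon_kh_k .$$ Let $x_1,x_2,\dots$ be random variables on a probability space $(\Omega,\mathfrak F,\mathbf P)$, each with density $f$, satisfying the uniform Cramér condition: there is $T>0$ with $\mathbf E e^{tx_i}<\infty$ for all $i$ and $|t|<T$. Fix $0<\kappa<B$, $\mathbb B=[\kappa,B]$, and put $$\Psi(b)=\int_{H-b}^{H+b}xf(x)\,dx-H\int_{H-b}^{H+b}f(x)\,dx .$$ Given a threshold $C>0$, the following iterative procedure is applied to the sample $x_1,\dots,x_N$. With $\theta_N$ the sample mean, for $b\in\mathbb B$ call $x_i$ ordinary if $|x_i-\theta_N|<b$ and abnormal otherwise, let $N_1(b),N_2(b)$ be the numbers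 of ordinary and abnormal observations, and let $$\Psi_N(b)=\frac1{N^2}\Big(N_2(b)\sum_{\text{ordinary}}x_i-N_1(b)\sum_{\text{abnormal}}x_i\Big).$$ If $\max_{b\in\mathbb B}|\Psi_N(b)|\le C$, the procedure stops. Otherwise the observations which are ordinary for a maximizer $b$ of $|\Psi_N|$ are removed as one class and the procedure is repeated on the remaining observations. A type 2 error occurs if the procedure stops at its first step, without removing any class. 1. (*$\psi$-mixing*) Suppose that $\psi(n)\to 0$, where $$\psi(n)=\sup_{t\ge1}\ \sup\Big\{\Big|\tfrac{\mathbf P(A\cap A')}{\mathbf P(A)\mathbf P(A')}-1\Big|:\ A\in\sigma(x_i,\,i\le t),\ A'\in\sigma(x_i,\,i\ge t+n),\ \mathbf P(A)\mathbf P(A')\ne0\Big\}.$$ Then there are a constant $L_1>0$ and a function $L_2:(0,\infty)\to(0,\infty)$ such that for every $C$ with $0<C<\max_{b\in\mathbb B}|\Psi(b)|$ and every $N\ge1$, with $\delta=\max_{b\in\mathbb B}|\Psi(b)|-C$, $$\mathbf P\{\text{type 2 error}\}\le L_1\exp(-\beta(\delta,N)),\qquad \beta(\delta,N)=L_2(\delta)\,N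 .$$ 2. (*weak dependence*) Suppose instead that $(x_i)$ is $(\theta,\mathcal L,\psi)$-weakly dependent: $\theta_r\to0$, and $$|\mathrm{Cov}(u(x_{i_1},\dots,x_{i_n}),v(x_{j_1},\dots,x_{j_m}))|\le\psi(u,v,n,m)\,\theta_r$$ for all $n,m\ge 1$, $r\ge 0$, $u\in\mathcal L_n$, $v\in\mathcal L_m$ and $i_1\le\dots\le i_n<i_n+r<j_1\le\dots\le j_m$. Suppose that $\theta_r\le A'e^{-ar}$ for some constants $A'\in\mathbb R$ and $a>0$; that each $\mathcal L_n$ contains all Lipschitz functions on $\mathbb R^n$ bounded by $1$ in absolute value; that $\psi\ge0$; and that for some $A$ and $p$, $\psi(u,v,n,m)\le A(n+m)^p(1+\mathrm{Lip}\,u)(1+\mathrm{Lip}\,v)$ for all such Lipschitz functions $u,v$ (Lipschitz constants with respect to the $\ell^1$ distance). Then the conclusion of 1 holds with $\beta(\delta,N)=L_2(\delta)\sqrt N$. -/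

import Mathlib

open MeasureTheory ProbabilityTheory Filter Topology
open scoped ENNReal

noncomputable section

namespace SwitchingMixture

/-! ### The mixture model -/

/-- `f` is a probability density on the real line with a finite first moment equal to `m`. -/
structure IsDensityWithMean (f : ℝ → ℝ) (m : ℝ) : Prop where
  measurable : Measurable f
  nonneg : ∀ x, 0 ≤ f x
  integrable : Integrable f
  integral_eq_one : ∫ x, f x = 1
  integrable_mul : Integrable fun x => x * f x
  mean_eq : ∫ x, x * f x = m

/-- If `f` is a density with mean zero, the shifted density `f(· - h)` has mean `h`, so that
shifted mixtures are mixtures of densities with means `0, h₁, …, h_k`. -/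
theorem IsDensityWithMean.shift {f : ℝ → ℝ} (hf : IsDensityWithMean f 0) (h : ℝ) :
    IsDensityWithMean (fun x => f (x - h)) h := by
  have e : (fun x : ℝ => x * f (x - h)) =
      fun x => (fun y => y * f y + h * f y) (x - h) := by
    funext x; ring
  have hi : Integrable (fun y : ℝ => y * f y + h * f y) :=
    hf.integrable_mul.add (hf.integrable.const_mul h)
  refine ⟨hf.measurable.comp (measurable_id.sub_const h), fun x => hf.nonneg _,
    hf.integrable.comp_sub_right h, ?_, ?_, ?_⟩
  · rw [integral_sub_right_eq_self (fun y => f y) h]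
    exact hf.integral_eq_one
  · rw [e]
    exact hi.comp_sub_right h
  · rw [e, integral_sub_right_eq_self (fun y => y * f y + h * f y) h,
      integral_add hf.integrable_mul (hf.integrable.const_mul h), hf.mean_eq,
      integral_const_mul, hf.integral_eq_one]
    ring

/-- `(1 - ε₁ - … - ε_k) f₀ + ε₁ f₁ + … + ε_k f_k`. -/
def mixtureDensity {k : ℕ} (f₀ : ℝ → ℝ) (f : Fin k → ℝ → ℝ) (ε : Fin k → ℝ) (x : ℝ) : ℝ :=
  (1 - ∑ j, ε j) * f₀ x + ∑ j, ε j * f j x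

/-- The mean `H = ε₁ h₁ + … + ε_k h_k` of the mixture. -/
def mixtureMean {k : ℕ} (ε h : Fin k → ℝ) : ℝ := ∑ j, ε j * h j

/-- `Ψ(b) = r(b) - H d(b)`, where `r(b)` and `d(b)` are the integrals of `x g(x)` and of `g(x)`
over `(H - b, H + b)`. -/
def limitPsi (g : ℝ → ℝ) (H b : ℝ) : ℝ :=
  (∫ x in (H - b)..(H + b), x * g x) - H * ∫ x in (H - b)..(H + b), g x

/-- `max_{b ∈ [κ, K]} |Ψ(b)|`. -/
def maxLimitPsi (g : ℝ → ℝ) (H κ K : ℝ) : ℝ :=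
  sSup ((fun b => |limitPsi g H b|) '' Set.Icc κ K)

/-! ### The classification procedure, for a (sub-)sample `(x i)`, `i ∈ S` -/

/-- The sample mean `θ`. -/
def sampleMean (x : ℕ → ℝ) (S : Finset ℕ) : ℝ := (∑ i ∈ S, x i) / (S.card : ℝ)

open Classical in
/-- The indices of the observations classified as ordinary: `|x i - θ| < b`. -/
def ordinary (x : ℕ → ℝ) (S : Finset ℕ) (b : ℝ) : Finset ℕ :=
  S.filter fun i => |x i - sampleMean x S| < b

/-- The indices of the observations classified as abnormal: `|x i - θ| ≥ b`. -/
def abnormal (x : ℕ → ℝ) (S : Finset ℕ) (b : ℝ) : Finset ℕ := S \ ordinary x S b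

/-- `Ψ_N(b) = N⁻² (N₂ · (sum of the ordinary observations) - N₁ · (sum of the abnormal ones))`. -/
def samplePsi (x : ℕ → ℝ) (S : Finset ℕ) (b : ℝ) : ℝ :=
  (((abnormal x S b).card : ℝ) * (∑ i ∈ ordinary x S b, x i)
    - ((ordinary x S b).card : ℝ) * ∑ i ∈ abnormal x S b, x i) / (S.card : ℝ) ^ 2

/-- The decision statistic `J = max_{b ∈ [κ, K]} |Ψ_N(b)|`. -/
def maxSamplePsi (x : ℕ → ℝ) (S : Finset ℕ) (κ K : ℝ) : ℝ :=
  sSup ((fun b => |samplePsi x S b|) '' Set.Icc κ K)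

/-- `Run x κ K C S cls`: started on the sub-sample `S`, the iterative procedure with decision
threshold `C` can split off successively the classes listed in `cls`, and stops. At each step, if
the threshold is not exceeded the procedure stops; otherwise the observations classified as
ordinary, for a maximizer `b` of the decision statistic, are split off as one class and the
procedure is repeated on the remaining ones. -/
inductive Run (x : ℕ → ℝ) (κ K C : ℝ) : Finset ℕ → List (Finset ℕ) → Prop
  | halt (S : Finset ℕ) (hJ : maxSamplePsi x S κ K ≤ C) : Run x κ K C S []
  | step (S : Finset ℕ) (b : ℝ) (cls : List (Finset ℕ)) (hJ : C < maxSamplePsi x S κ K)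
      (hb : b ∈ Set.Icc κ K) (hmax : ∀ b' ∈ Set.Icc κ K, |samplePsi x S b'| ≤ |samplePsi x S b|)
      (hrest : Run x κ K C (abnormal x S b) cls) :
      Run x κ K C S (ordinary x S b :: cls)

/-- The event of a type 2 error for the sample `X 0, …, X (N - 1)`: the iterative procedure stops
at its first step, without splitting off any class. -/
def type2Error {Ω : Type*} (X : ℕ → Ω → ℝ) (κ K C : ℝ) (N : ℕ) : Set Ω :=
  {ω | Run (fun i => X i ω) κ K C (Finset.range N) []}

theorem mem_type2Error {Ω : Type*} (X : ℕ → Ω → ℝ) (κ K C : ℝ) (N : ℕ) (ω : Ω) :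
    ω ∈ type2Error X κ K C N ↔ maxSamplePsi (fun i => X i ω) (Finset.range N) κ K ≤ C := by
  constructor
  · intro h
    cases h with
    | halt _ hJ => exact hJ
  · intro h
    exact Run.halt _ h

/-! ### Dependence and moment conditions -/

/-- The `ψ`-measure of dependence between two `σ`-algebras. -/
def psiDep {Ω : Type*} [MeasurableSpace Ω] (P : Measure Ω) (m₁ m₂ : MeasurableSpace Ω) : ℝ≥0∞ :=
  ⨆ (A : Set Ω) (B : Set Ω) (_ : MeasurableSet[m₁] A) (_ : MeasurableSet[m₂] B)
    (_ : P.real A * P.real B ≠ 0),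
    ENNReal.ofReal |P.real (A ∩ B) / (P.real A * P.real B) - 1|

/-- The `σ`-algebra generated by the `X i` with `i ∈ I`. -/
abbrev sigmaGen {Ω : Type*} (X : ℕ → Ω → ℝ) (I : Set ℕ) : MeasurableSpace Ω :=
  ⨆ i ∈ I, MeasurableSpace.comap (X i) inferInstance

/-- The `ψ`-mixing coefficient `ψ(n)` of the sequence `X`. -/
def psiCoeff {Ω : Type*} [MeasurableSpace Ω] (P : Measure Ω) (X : ℕ → Ω → ℝ) (n : ℕ) : ℝ≥0∞ :=
  ⨆ t : ℕ, psiDep P (sigmaGen X (Set.Iic t)) (sigmaGen X (Set.Ici (t + n)))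

/-- The `ψ`-mixing condition. -/
def IsPsiMixing {Ω : Type*} [MeasurableSpace Ω] (P : Measure Ω) (X : ℕ → Ω → ℝ) : Prop :=
  Tendsto (psiCoeff P X) atTop (𝓝 0)

/-- The `(θ, L, ψ)`-weak dependence condition of Doukhan and Louhichi. -/
def IsWeaklyDependent {Ω : Type*} [MeasurableSpace Ω] (P : Measure Ω) (X : ℕ → Ω → ℝ)
    (L : (n : ℕ) → Set ((Fin n → ℝ) → ℝ))
    (ψ : (n m : ℕ) → ((Fin n → ℝ) → ℝ) → ((Fin m → ℝ) → ℝ) → ℝ) (θ : ℕ → ℝ) : Prop :=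
  Tendsto θ atTop (𝓝 0) ∧
    ∀ (n m r : ℕ), 1 ≤ n → 1 ≤ m → ∀ f ∈ L n, ∀ g ∈ L m,
      ∀ (i : Fin n → ℕ) (j : Fin m → ℕ), Monotone i → Monotone j → (∀ a b, i a + r < j b) →
        |cov[fun ω => f (fun a => X (i a) ω), fun ω => g (fun b => X (j b) ω); P]|
          ≤ ψ n m f g * θ r

/-- `f` is Lipschitz with constant `c` for the `ℓ¹` distance. -/
def IsLip {n : ℕ} (f : (Fin n → ℝ) → ℝ) (c : ℝ) : Prop :=
  0 ≤ c ∧ ∀ x y, |f x - f y| ≤ c * ∑ i, |x i - y i|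

/-- The Lipschitz functions of `n` real variables bounded by one. -/
def lipClass (n : ℕ) : Set ((Fin n → ℝ) → ℝ) :=
  {f | (∀ x, |f x| ≤ 1) ∧ ∃ c, IsLip f c}

/-- A weak dependence structure `(L, ψ)` is admissible if the test classes contain the Lipschitz
functions bounded by one, and on these the nonnegative weight `ψ` grows at most polynomially in
the numbers of variables and at most linearly in each Lipschitz constant. With `‖f‖, ‖g‖ ≤ 1`,
this holds for all of the usual weights: `n Lip f + m Lip g`, `n m Lip f Lip g`,
`min(n, m) Lip f Lip g`, `‖f‖ ‖g‖`, their sums and their multiples. -/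
structure IsAdmissible (L : (n : ℕ) → Set ((Fin n → ℝ) → ℝ))
    (ψ : (n m : ℕ) → ((Fin n → ℝ) → ℝ) → ((Fin m → ℝ) → ℝ) → ℝ) : Prop where
  lipClass_subset : ∀ n, lipClass n ⊆ L n
  nonneg : ∀ (n m : ℕ) f g, 0 ≤ ψ n m f g
  growth : ∃ (A : ℝ) (p : ℕ), ∀ (n m : ℕ), 1 ≤ n → 1 ≤ m →
    ∀ f ∈ lipClass n, ∀ g ∈ lipClass m, ∀ cf cg : ℝ, IsLip f cf → IsLip g cg →
      ψ n m f g ≤ A * ((n : ℝ) + m) ^ p * (1 + cf) * (1 + cg)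

/-- Exponential decay of the weak dependence coefficients. -/
def HasExpDecay (θ : ℕ → ℝ) : Prop :=
  ∃ A a : ℝ, 0 < a ∧ ∀ r : ℕ, θ r ≤ A * Real.exp (-a * r)

/-- The uniform Cramér condition. -/
def UniformCramer {Ω : Type*} [MeasurableSpace Ω] (P : Measure Ω) (X : ℕ → Ω → ℝ) : Prop :=
  ∃ T > 0, ∀ i, ∀ t : ℝ, |t| < T → Integrable (fun ω => Real.exp (t * X i ω)) P

end SwitchingMixture

end

/-! A type 2 error forces `|Ψ_N(b)| ≤ C` for every `b`, so it suffices to fix one `b` with `|Ψ(b)| >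
C` and show that `Ψ_N(b)` is close to `Ψ(b)` outside an event of exponentially small probability. No
uniformity in `b` is needed.

With `cutoff b` the identity set to zero outside `(-b, b)`, `Ψ_N(b)` is the sample mean of `cutoff b
(x_i - θ_N)` (`samplePsi_eq`), and `Ψ(b)` is the expectation of `cutoff b (x - H)`
(`limitPsi_eq_integral_cutoff`). The random centre and the two jumps are removed by a Lipschitz
approximation whose error is controlled by a Lipschitz tent around `±b`; the law has no atoms, so
this tent has small mean. What remains is a deviation bound for sums of Lipschitz functions of the
observations, `HasLipschitzDeviations`.

That bound is proved by Chernoff's method on residue classes of indices. In the `ψ`-mixing case a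
fixed spacing makes exponential moments factorize up to a factor `1 + q` per term, which the
Chernoff gain absorbs; the classes have length of order `N`. Under weak dependence the exponential
must first be capped to be an admissible test function. The cap costs `exp (2Q)`, with `Q`
proportional to the class length, and only the decay `exp (-a r)` over the gap `r` can pay for it.
So length and gap are both of order `√N`, which is the rate obtained. -/

namespace SwitchingMixture

section

/-! ### Sequences that decay exponentially at a given rate -/

/-- `u N = O(exp (-c * rate N))` for some `c > 0`, uniformly in `N ≥ 1`. -/
def ExpSmall (rate u : ℕ → ℝ) : Prop :=
  ∃ C c : ℝ, 0 < c ∧ ∀ N, 1 ≤ N → u N ≤ C * Real.exp (-(c * rate N))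

theorem ExpSmall.mono {rate u v : ℕ → ℝ} (hv : ExpSmall rate v) (h : ∀ N, 1 ≤ N → u N ≤ v N) :
    ExpSmall rate u := by
  obtain ⟨C, c, hc, hC⟩ := hv
  exact ⟨C, c, hc, fun N hN => (h N hN).trans (hC N hN)⟩

theorem ExpSmall.add {rate u v : ℕ → ℝ} (hr : ∀ N, 0 ≤ rate N) (hu : ExpSmall rate u)
    (hv : ExpSmall rate v) : ExpSmall rate (fun N => u N + v N) := by
  obtain ⟨C, c, hc, hC⟩ := hu
  obtain ⟨D, d, hd, hD⟩ := hv
  refine ⟨|C| + |D|, min c d, lt_min hc hd, fun N hN => ?_⟩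
  have h1 : Real.exp (-(c * rate N)) ≤ Real.exp (-(min c d * rate N)) := by
    gcongr
    · exact hr N
    · exact min_le_left _ _
  have h2 : Real.exp (-(d * rate N)) ≤ Real.exp (-(min c d * rate N)) := by
    gcongr
    · exact hr N
    · exact min_le_right _ _
  rw [add_mul]
  apply add_le_add
  · exact (hC N hN).trans (mul_le_mul (le_abs_self C) h1 (Real.exp_pos _).le (abs_nonneg _))
  · exact (hD N hN).trans (mul_le_mul (le_abs_self D) h2 (Real.exp_pos _).le (abs_nonneg _))

/-- The finitely many early indices are absorbed by enlarging the constant, since `u ≤ 1`. -/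
theorem ExpSmall.of_eventually {rate u : ℕ → ℝ} (hu : ∀ N, u N ≤ 1) {C c : ℝ} (hc : 0 < c)
    {N₀ : ℕ} (h : ∀ N, N₀ ≤ N → u N ≤ C * Real.exp (-(c * rate N))) : ExpSmall rate u := by
  refine ⟨|C| + ∑ i ∈ Finset.range N₀, Real.exp (c * rate i), c, hc, fun N _ => ?_⟩
  have hS : 0 ≤ ∑ i ∈ Finset.range N₀, Real.exp (c * rate i) :=
    Finset.sum_nonneg fun _ _ => (Real.exp_pos _).le
  rw [add_mul]
  rcases le_or_gt N₀ N with hN | hN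
  · have := mul_le_mul_of_nonneg_right (le_abs_self C) (Real.exp_pos (-(c * rate N))).le
    have := mul_nonneg hS (Real.exp_pos (-(c * rate N))).le
    linarith [h N hN]
  · have h1 : Real.exp (c * rate N) ≤ ∑ i ∈ Finset.range N₀, Real.exp (c * rate i) :=
      Finset.single_le_sum (f := fun i => Real.exp (c * rate i)) (fun _ _ => (Real.exp_pos _).le)
        (Finset.mem_range.2 hN)
    have h2 := mul_le_mul_of_nonneg_right h1 (Real.exp_pos (-(c * rate N))).le
    rw [← Real.exp_add, add_neg_cancel, Real.exp_zero] at h2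
    have := mul_nonneg (abs_nonneg C) (Real.exp_pos (-(c * rate N))).le
    linarith [hu N]

/-- For sequences bounded by one the multiplicative constant can be taken to be `e`. -/
theorem ExpSmall.exists_universal {rate u : ℕ → ℝ} (hu : ∀ N, u N ≤ 1) (h : ExpSmall rate u) :
    ∃ c : ℝ, 0 < c ∧ ∀ N, 1 ≤ N → u N ≤ Real.exp 1 * Real.exp (-(c * rate N)) := by
  obtain ⟨C, c, hc, hC⟩ := h
  set D := max C 1
  have hD : 1 ≤ D := le_max_right _ _
  have hl : 0 ≤ Real.log D := Real.log_nonneg hD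
  -- The constant `D` is traded for a slower rate. While `c * rate N ≤ log D` the new exponent is at
  -- most one, so the bound exceeds `1`; beyond that point the old bound implies the new one. This
  -- is what later keeps `L₁` independent of `δ`.
  refine ⟨c / (1 + Real.log D), by positivity, fun N hN => ?_⟩
  rw [← Real.exp_add]
  set l := Real.log D
  rcases le_total (c * rate N) l with h1 | h1
  · refine (hu N).trans (Real.one_le_exp ?_)
    have : c / (1 + l) * rate N ≤ 1 := by
      rw [div_mul_eq_mul_div, div_le_one (by positivity)]
      linarith
    linarith
  · calc u N ≤ D * Real.exp (-(c * rate N)) :=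
          (hC N hN).trans (mul_le_mul_of_nonneg_right (le_max_left _ _) (Real.exp_pos _).le)
      _ = Real.exp (l + -(c * rate N)) := by
          rw [Real.exp_add, Real.exp_log (by positivity)]
      _ ≤ _ := by
          apply Real.exp_le_exp.2
          have e : c / (1 + l) * rate N = c * rate N / (1 + l) := by ring
          rw [e]
          have : c * rate N / (1 + l) ≤ 1 + c * rate N - l := by
            rw [div_le_iff₀ (by positivity)]
            nlinarith [mul_nonneg hl (sub_nonneg.2 h1)]
          linarith

/-- Polynomials are dominated by exponentials. -/
theorem exists_pow_mul_exp_le (q : ℕ) {b : ℝ} (hb : 0 < b) :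
    ∃ C : ℝ, 0 ≤ C ∧ ∀ s : ℕ, ((s : ℝ) + 2) ^ q * Real.exp (-(b * s)) ≤ C := by
  refine ⟨q.factorial * Real.exp (2 * b) / b ^ q, by positivity, fun s => ?_⟩
  have h := Real.pow_div_factorial_le_exp (x := b * ((s : ℝ) + 2)) (by positivity) q
  rw [div_le_iff₀ (by positivity), mul_pow] at h
  rw [le_div_iff₀ (by positivity)]
  have e : Real.exp (b * ((s : ℝ) + 2)) = Real.exp (2 * b) * Real.exp (b * s) := by
    rw [← Real.exp_add]; ring_nf
  rw [e] at h
  have e2 : Real.exp (b * s) * Real.exp (-(b * s)) = 1 := by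
    rw [← Real.exp_add, add_neg_cancel, Real.exp_zero]
  calc ((s : ℝ) + 2) ^ q * Real.exp (-(b * s)) * b ^ q
      = (b ^ q * ((s : ℝ) + 2) ^ q) * Real.exp (-(b * s)) := by ring
    _ ≤ (Real.exp (2 * b) * Real.exp (b * s) * q.factorial) * Real.exp (-(b * s)) := by gcongr
    _ = q.factorial * Real.exp (2 * b) * (Real.exp (b * s) * Real.exp (-(b * s))) := by ring
    _ = _ := by rw [e2, mul_one]

/-! ### Splitting into residue classes -/

theorem sum_range_mul_eq_sum_residue (g : ℕ → ℝ) (R K : ℕ) :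
    ∑ i ∈ Finset.range (K * R), g i =
      ∑ c ∈ Finset.range R, ∑ j ∈ Finset.range K, g (c + j * R) := by
  induction K with
  | zero => simp
  | succ K ih =>
    rw [Nat.succ_mul, Finset.sum_range_add, ih, ← Finset.sum_add_distrib]
    refine Finset.sum_congr rfl fun c _ => ?_
    rw [Finset.sum_range_succ, add_comm c]

variable {Ω : Type*} [MeasurableSpace Ω] {P : Measure Ω} [IsProbabilityMeasure P]

/-- If the sum of `N` nonnegative variables is large, so is the sum over one of the `R` residue
classes, completed to `K` terms each. -/
theorem measureReal_sum_ge_le_mul {Y : ℕ → Ω → ℝ} (hY : ∀ i ω, 0 ≤ Y i ω) {R K N : ℕ} {d D β : ℝ}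
    (hN : N ≤ K * R) (hd : d * (K * R) ≤ D * N) (hR : 0 < R)
    (h : ∀ c, P.real {ω | d * K ≤ ∑ j ∈ Finset.range K, Y (c + j * R) ω} ≤ β) :
    P.real {ω | D * N ≤ ∑ i ∈ Finset.range N, Y i ω} ≤ R * β := by
  calc P.real {ω | D * N ≤ ∑ i ∈ Finset.range N, Y i ω}
      ≤ P.real (⋃ c ∈ Finset.range R,
          {ω | d * K ≤ ∑ j ∈ Finset.range K, Y (c + j * R) ω}) := by
        refine measureReal_mono (fun ω hω => ?_) (measure_ne_top _ _)
        -- Nonnegativity allows padding the sum up to a multiple of `R`; the margin between `d` and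
        -- `D` pays for the additional terms.
        have h1 : d * (K * R) ≤ ∑ i ∈ Finset.range (K * R), Y i ω :=
          (hd.trans hω).trans (Finset.sum_le_sum_of_subset_of_nonneg
            (Finset.range_mono hN) fun i _ _ => hY i ω)
        rw [sum_range_mul_eq_sum_residue] at h1
        by_contra hcon
        simp only [Set.mem_iUnion, not_exists, Set.mem_ofPred_eq, not_le] at hcon
        have h2 := Finset.sum_lt_sum_of_nonempty (Finset.nonempty_range_iff.2 hR.ne')
          fun c hc => hcon c hc
        simp only [Finset.sum_const, Finset.card_range, nsmul_eq_mul] at h2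
        nlinarith
    _ ≤ ∑ c ∈ Finset.range R, P.real {ω | d * K ≤ ∑ j ∈ Finset.range K, Y (c + j * R) ω} :=
        measureReal_biUnion_finset_le _ _
    _ ≤ ∑ c ∈ Finset.range R, β := Finset.sum_le_sum fun c _ => h c
    _ = R * β := by simp

/-! ### Exponential moments -/

/-- Chernoff: if `d` exceeds the mean, then `E exp (t (Y - d)) < 1` for some small `t > 0`. -/
theorem exists_mgf_mul_exp_lt_one {Y : Ω → ℝ} {s : ℝ} (hs : 0 < s)
    (hY : ∀ t, |t| < s → Integrable (fun ω => Real.exp (t * Y ω)) P) {d : ℝ} (hd : ∫ ω, Y ω ∂P < d)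
    {τ : ℝ} (hτ : 0 < τ) :
    ∃ t, 0 < t ∧ t < τ ∧ t < s ∧ mgf Y P t * Real.exp (-(t * d)) < 1 := by
  have h0 : (0 : ℝ) ∈ interior (integrableExpSet Y P) := by
    rw [mem_interior]
    refine ⟨Metric.ball 0 s, fun t ht => hY t ?_, Metric.isOpen_ball, Metric.mem_ball_self hs⟩
    simpa using ht
  have h1 := hasDerivAt_mgf h0
  have h2 : HasDerivAt (fun t => Real.exp (-(t * d))) (-d) 0 := by
    have := ((hasDerivAt_id (0 : ℝ)).mul_const d).neg.exp
    simpa using this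
  have h3 := h1.mul h2
  -- The function `mgf Y P t * exp (-(t * d))` equals `1` at `t = 0` and has derivative `E Y - d <
  -- 0` there.
  simp only [zero_mul, Real.exp_zero, mul_one, neg_zero, mgf_zero, one_mul] at h3
  have h4 := (hasDerivAt_iff_tendsto_slope.1 h3).eventually_lt_const
    (show ∫ ω, Y ω ∂P + -d < 0 by linarith)
  have h5 : ∀ᶠ t in 𝓝[>] (0 : ℝ), slope (mgf Y P * fun t => Real.exp (-(t * d))) 0 t < 0 :=
    h4.filter_mono (nhdsWithin_mono _ fun t (ht : 0 < t) => ht.ne')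
  obtain ⟨t, ⟨ht0, ht1⟩, ht2⟩ :=
    (Filter.Eventually.and (Ioo_mem_nhdsGT (lt_min hτ hs)) h5).exists
  refine ⟨t, ht0, ht1.trans_le (min_le_left _ _), ht1.trans_le (min_le_right _ _), ?_⟩
  rw [slope_def_field, sub_zero, div_neg_iff] at ht2
  rcases ht2 with ⟨_, h⟩ | ⟨h, _⟩
  · linarith
  · simpa using h

end

/-! ### Lipschitz deviation bounds and their reduction to nonnegative functions. -/

section

variable {Ω : Type*} [MeasurableSpace Ω] {P : Measure Ω}

/-- The sums of `F (X i)` exceed their means only with exponentially small probability, for every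
Lipschitz function `F`. -/
def HasLipschitzDeviations (P : Measure Ω) (X : ℕ → Ω → ℝ) (rate : ℕ → ℝ) : Prop :=
  ∀ (ℓ : NNReal) (F : ℝ → ℝ), LipschitzWith ℓ F → ∀ d : ℝ, ∫ ω, F (X 0 ω) ∂P < d →
    ExpSmall rate fun N => P.real {ω | d * N ≤ ∑ i ∈ Finset.range N, F (X i ω)}

theorem UniformCramer.exists_integrable_exp_lipschitz {X : ℕ → Ω → ℝ} (hC : UniformCramer P X)
    (hX : ∀ i, Measurable (X i)) {ℓ : NNReal} {F : ℝ → ℝ} (hF : LipschitzWith ℓ F) :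
    ∃ s > 0, ∀ i, ∀ t : ℝ, |t| < s → Integrable (fun ω => Real.exp (t * F (X i ω))) P := by
  obtain ⟨T, hT, hI⟩ := hC
  -- The bound is `|F x| ≤ |F 0| + ℓ |x|` combined with `exp |u| ≤ exp u + exp (-u)`; the `+ 1`
  -- covers `ℓ = 0`.
  refine ⟨T / (ℓ + 1), by positivity, fun i t ht => ?_⟩
  rw [lt_div_iff₀ (by positivity)] at ht
  have hu : |t * ℓ| < T := by
    rw [abs_mul, NNReal.abs_eq]
    nlinarith [abs_nonneg t, ℓ.2]
  have h1 := ((hI i (t * ℓ) hu).add (hI i (-(t * ℓ)) (by rwa [abs_neg]))).const_mul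
    (Real.exp (|t| * |F 0|))
  refine h1.mono' ?_ (ae_of_all _ fun ω => ?_)
  · exact (Real.measurable_exp.comp
      ((hF.continuous.measurable.comp (hX i)).const_mul t)).aestronglyMeasurable
  · rw [Real.norm_eq_abs, Real.abs_exp, Pi.add_apply]
    have h2 : |F (X i ω)| ≤ |F 0| + ℓ * |X i ω| := by
      have := hF.dist_le_mul (X i ω) 0
      rw [Real.dist_eq, Real.dist_eq, sub_zero] at this
      have := abs_sub_abs_le_abs_sub (F (X i ω)) (F 0)
      linarith
    have h3 : t * F (X i ω) ≤ |t| * |F 0| + |t * ℓ * X i ω| := by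
      calc t * F (X i ω) ≤ |t| * |F (X i ω)| := by rw [← abs_mul]; exact le_abs_self _
        _ ≤ |t| * (|F 0| + ℓ * |X i ω|) := by gcongr
        _ = _ := by rw [abs_mul, abs_mul, NNReal.abs_eq]; ring
    calc Real.exp (t * F (X i ω)) ≤ Real.exp (|t| * |F 0| + |t * ℓ * X i ω|) :=
          Real.exp_le_exp.2 h3
      _ = Real.exp (|t| * |F 0|) * Real.exp |t * ℓ * X i ω| := Real.exp_add _ _
      _ ≤ _ := by
          gcongr
          rw [neg_mul]
          exact Real.exp_abs_le _

theorem UniformCramer.integrable_lipschitz {X : ℕ → Ω → ℝ} (hC : UniformCramer P X)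
    (hX : ∀ i, Measurable (X i)) {ℓ : NNReal} {F : ℝ → ℝ} (hF : LipschitzWith ℓ F) (i : ℕ) :
    Integrable (fun ω => F (X i ω)) P := by
  obtain ⟨s, hs, h⟩ := hC.exists_integrable_exp_lipschitz hX hF
  apply integrable_of_mem_interior_integrableExpSet
  rw [mem_interior]
  exact ⟨Metric.ball 0 s, fun t ht => h i t (by simpa using ht), Metric.isOpen_ball,
    Metric.mem_ball_self hs⟩

variable [IsProbabilityMeasure P]

/-- It is enough to bound the deviations for nonnegative Lipschitz functions. -/
theorem HasLipschitzDeviations.of_nonneg {X : ℕ → Ω → ℝ} (hC : UniformCramer P X)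
    (hX : ∀ i, Measurable (X i)) {rate : ℕ → ℝ}
    (h : ∀ (ℓ : NNReal) (F : ℝ → ℝ), LipschitzWith ℓ F → (∀ x, 0 ≤ F x) → ∀ d : ℝ,
      ∫ ω, F (X 0 ω) ∂P < d →
      ExpSmall rate fun N => P.real {ω | d * N ≤ ∑ i ∈ Finset.range N, F (X i ω)}) :
    HasLipschitzDeviations P X rate := by
  intro ℓ F hF d hd
  have hFi := hC.integrable_lipschitz hX hF 0
  have hlim : Tendsto (fun M : ℕ => ∫ ω, max (F (X 0 ω)) (-(M : ℝ)) ∂P) atTop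
      (𝓝 (∫ ω, F (X 0 ω) ∂P)) := by
    refine tendsto_integral_of_dominated_convergence (fun ω => |F (X 0 ω)|)
      (fun M => ?_) hFi.abs (fun M => ae_of_all _ fun ω => ?_) (ae_of_all _ fun ω => ?_)
    · exact hFi.aestronglyMeasurable.sup aestronglyMeasurable_const
    · rw [Real.norm_eq_abs]
      have hM : (0 : ℝ) ≤ M := M.cast_nonneg
      rcases le_total (F (X 0 ω)) (-(M : ℝ)) with h1 | h1
      · rw [max_eq_right h1, abs_neg, abs_of_nonneg hM, abs_of_nonpos (by linarith)]
        linarith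
      · rw [max_eq_left h1]
    · obtain ⟨M₀, hM₀⟩ := exists_nat_ge (-F (X 0 ω))
      refine tendsto_const_nhds.congr' ?_
      filter_upwards [eventually_ge_atTop M₀] with M hM
      have : (M₀ : ℝ) ≤ M := by exact_mod_cast hM
      rw [max_eq_left (by linarith)]
  -- Truncating below at `-M` only increases the sums and, for large `M`, keeps the mean below `d`;
  -- adding `M` then makes the function nonnegative.
  obtain ⟨M, hM⟩ := (hlim.eventually_lt_const hd).exists
  have hG : LipschitzWith ℓ fun x => max (F x) (-(M : ℝ)) := hF.max_const _
  have hG' : LipschitzWith ℓ fun x => max (F x) (-(M : ℝ)) + M := by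
    intro x y
    simpa [edist_add_right] using hG x y
  refine (h ℓ _ hG' (fun x => ?_) (d + M) ?_).mono fun N _ => ?_
  · have := le_max_right (F x) (-(M : ℝ))
    linarith
  · rw [integral_add (hC.integrable_lipschitz hX hG 0) (integrable_const _)]
    simpa using hM
  · refine measureReal_mono (fun ω hω => ?_) (measure_ne_top _ _)
    simp only [Set.mem_ofPred_eq] at hω ⊢
    rw [Finset.sum_add_distrib, Finset.sum_const, Finset.card_range, nsmul_eq_mul]
    have : ∑ i ∈ Finset.range N, F (X i ω) ≤ ∑ i ∈ Finset.range N, max (F (X i ω)) (-(M : ℝ)) :=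
      Finset.sum_le_sum fun i _ => le_max_left _ _
    linarith

/-! ### `ψ`-mixing sequences -/

theorem measure_inter_le_of_psiDep_le {Ω : Type*} {m₁ m₂ mΩ : MeasurableSpace Ω}
    {P : Measure Ω} [IsProbabilityMeasure P] {q : ℝ} (hq : 0 ≤ q)
    (h : psiDep P m₁ m₂ ≤ ENNReal.ofReal q) {A B : Set Ω} (hA : MeasurableSet[m₁] A)
    (hB : MeasurableSet[m₂] B) : P (A ∩ B) ≤ ENNReal.ofReal (1 + q) * P A * P B := by
  rw [← ofReal_measureReal, ← ofReal_measureReal (s := A), ← ofReal_measureReal (s := B),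
    ← ENNReal.ofReal_mul (by positivity), ← ENNReal.ofReal_mul (by positivity)]
  apply ENNReal.ofReal_le_ofReal
  by_cases h0 : P.real A * P.real B = 0
  · have h1 : P.real (A ∩ B) ≤ P.real A := measureReal_mono Set.inter_subset_left
    have h2 : P.real (A ∩ B) ≤ P.real B := measureReal_mono Set.inter_subset_right
    rw [mul_assoc, h0, mul_zero]
    rcases mul_eq_zero.1 h0 with h3 | h3 <;> linarith
  · have h1 : ENNReal.ofReal |P.real (A ∩ B) / (P.real A * P.real B) - 1| ≤ ENNReal.ofReal q := by
      refine le_trans (le_iSup₂_of_le A B (le_iSup₂_of_le hA hB ?_)) h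
      rw [iSup_pos h0]
    have h2 := (abs_le.1 ((ENNReal.ofReal_le_ofReal_iff hq).1 h1)).2
    have h3 : 0 < P.real A * P.real B := lt_of_le_of_ne (by positivity) (Ne.symm h0)
    have h4 : P.real (A ∩ B) / (P.real A * P.real B) ≤ 1 + q := by linarith
    rw [div_le_iff₀ h3] at h4
    linarith

/-- The bound on events is extended one factor at a time as a comparison of measures: first
`P.restrict A` on `m₂`, which handles `V`, then `P.withDensity V` on `m₁`, which handles `U`.
Trimming is essential, as the comparisons are known only on the sub-`σ`-algebras. -/
theorem lintegral_mul_le_of_psiDep_le {Ω : Type*} {m₁ m₂ mΩ : MeasurableSpace Ω} {P : Measure Ω}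
    [IsProbabilityMeasure P] (hm₁ : m₁ ≤ mΩ) (hm₂ : m₂ ≤ mΩ) {q : ℝ} (hq : 0 ≤ q)
    (h : psiDep P m₁ m₂ ≤ ENNReal.ofReal q) {U V : Ω → ℝ≥0∞} (hU : Measurable[m₁] U)
    (hV : Measurable[m₂] V) :
    ∫⁻ ω, U ω * V ω ∂P ≤ ENNReal.ofReal (1 + q) * (∫⁻ ω, U ω ∂P) * ∫⁻ ω, V ω ∂P := by
  have key : ∀ A, MeasurableSet[m₁] A →
      ∫⁻ ω in A, V ω ∂P ≤ ENNReal.ofReal (1 + q) * P A * ∫⁻ ω, V ω ∂P := by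
    intro A hA
    have hle : (P.restrict A).trim hm₂ ≤ (ENNReal.ofReal (1 + q) * P A) • P.trim hm₂ := by
      refine Measure.le_iff.2 fun B hB => ?_
      rw [Measure.smul_apply, trim_measurableSet_eq hm₂ hB, trim_measurableSet_eq hm₂ hB,
        Measure.restrict_apply (hm₂ _ hB), Set.inter_comm, smul_eq_mul]
      exact measure_inter_le_of_psiDep_le hq h hA hB
    rw [← lintegral_trim hm₂ hV, ← lintegral_trim hm₂ hV, ← smul_eq_mul (_ * _),
      ← lintegral_smul_measure]
    exact lintegral_mono' hle le_rfl
  have hle : (P.withDensity V).trim hm₁ ≤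
      (ENNReal.ofReal (1 + q) * ∫⁻ ω, V ω ∂P) • P.trim hm₁ := by
    refine Measure.le_iff.2 fun A hA => ?_
    rw [Measure.smul_apply, trim_measurableSet_eq hm₁ hA, trim_measurableSet_eq hm₁ hA,
      withDensity_apply _ (hm₁ _ hA), smul_eq_mul]
    exact (key A hA).trans_eq (by ring)
  have h1 : ∫⁻ ω, U ω * V ω ∂P = ∫⁻ ω, U ω ∂(P.withDensity V) := by
    rw [lintegral_withDensity_eq_lintegral_mul _ (hV.mono hm₂ le_rfl) (hU.mono hm₁ le_rfl)]
    simp only [Pi.mul_apply, mul_comm]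
  calc ∫⁻ ω, U ω * V ω ∂P
      = ∫⁻ ω, U ω ∂((P.withDensity V).trim hm₁) := by rw [h1, lintegral_trim hm₁ hU]
    _ ≤ ∫⁻ ω, U ω ∂((ENNReal.ofReal (1 + q) * ∫⁻ ω, V ω ∂P) • P.trim hm₁) :=
        lintegral_mono' hle le_rfl
    _ = _ := by
        rw [lintegral_smul_measure, lintegral_trim hm₁ hU, smul_eq_mul]
        ring

theorem sigmaGen_le {X : ℕ → Ω → ℝ} (hX : ∀ i, Measurable (X i)) (I : Set ℕ) :
    sigmaGen X I ≤ ‹MeasurableSpace Ω› :=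
  iSup₂_le fun i _ => (hX i).comap_le

theorem measurable_sigmaGen {Ω : Type*} (X : ℕ → Ω → ℝ) {I : Set ℕ} {i : ℕ} (hi : i ∈ I) :
    Measurable[sigmaGen X I] (X i) :=
  Measurable.mono (comap_measurable (X i)) (le_iSup₂_of_le i hi le_rfl) le_rfl

/-- Under `ψ`-mixing, expectations of products over well separated indices factorize up to a factor
`1 + q` for each index. -/
theorem lintegral_prod_le_of_psiCoeff_le {X : ℕ → Ω → ℝ} (hX : ∀ i, Measurable (X i)) {q : ℝ}
    (hq : 0 ≤ q) {R : ℕ} (h : psiCoeff P X R ≤ ENNReal.ofReal q) {G : ℝ → ℝ≥0∞}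
    (hG : Measurable G) {m : ℝ≥0∞} (hm : ∀ i, ∫⁻ ω, G (X i ω) ∂P ≤ m) (c K : ℕ) :
    ∫⁻ ω, ∏ j ∈ Finset.range K, G (X (c + j * R) ω) ∂P ≤ (ENNReal.ofReal (1 + q) * m) ^ K := by
  induction K with
  | zero => simp
  | succ K ih =>
    -- A single factor has no past. Otherwise the past ends at `c + K * R`, exactly `R` before the
    -- new index.
    rcases K with _ | K
    · simp only [zero_add, Finset.range_one, Finset.prod_singleton, pow_one]
      refine (hm _).trans (le_mul_of_one_le_left' ?_)
      rw [ENNReal.one_le_ofReal]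
      linarith
    · simp only [Finset.prod_range_succ _ (K + 1)]
      have h1 : psiDep P (sigmaGen X (Set.Iic (c + K * R))) (sigmaGen X (Set.Ici (c + K * R + R)))
          ≤ ENNReal.ofReal q := le_trans (le_iSup_of_le (c + K * R) le_rfl) h
      have h2 := lintegral_mul_le_of_psiDep_le (sigmaGen_le hX _) (sigmaGen_le hX _) hq h1
        (U := fun ω => ∏ j ∈ Finset.range (K + 1), G (X (c + j * R) ω))
        (V := fun ω => G (X (c + (K + 1) * R) ω)) ?_ ?_
      · refine h2.trans ?_
        rw [pow_succ (_ * m), mul_comm (ENNReal.ofReal (1 + q)) (∫⁻ _, _ ∂P), mul_assoc]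
        gcongr
        exact hm _
      · refine Finset.measurable_fun_prod _ fun j hj => hG.comp (measurable_sigmaGen X ?_)
        have : j * R ≤ K * R := Nat.mul_le_mul_right _ (Nat.lt_succ_iff.1 (Finset.mem_range.1 hj))
        simp only [Set.mem_Iic]
        omega
      · refine hG.comp (measurable_sigmaGen X ?_)
        simp only [Set.mem_Ici]
        rw [Nat.succ_mul]
        omega

/-- The spacing `R` is fixed so that the dependence factor `1 + q` does not exhaust the Chernoff
factor `ρ < 1`. Each of the `R` residue classes then has deviation probability at most `((1 + q) ρ)
^ K`, with `K` of order `N / R`. -/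
theorem IsPsiMixing.hasLipschitzDeviations {X : ℕ → Ω → ℝ} (hmix : IsPsiMixing P X)
    (hC : UniformCramer P X) (hX : ∀ i, Measurable (X i))
    (hlaw : ∀ i, P.map (X i) = P.map (X 0)) :
    HasLipschitzDeviations P X fun N => N := by
  refine .of_nonneg hC hX fun ℓ F hF hF0 D hD => ?_
  have hFm : Measurable F := hF.continuous.measurable
  have hmean : 0 ≤ ∫ ω, F (X 0 ω) ∂P := integral_nonneg fun ω => hF0 _
  obtain ⟨d, hd1, hd2⟩ := exists_between hD
  have hd0 : 0 < d := hmean.trans_lt hd1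
  obtain ⟨s, hs, hexp⟩ := hC.exists_integrable_exp_lipschitz hX hF
  obtain ⟨t, ht0, -, hts, ht⟩ := exists_mgf_mul_exp_lt_one hs (hexp 0) hd1 one_pos
  set m := mgf (fun ω => F (X 0 ω)) P t with hm
  have hm0 : 0 < m := mgf_pos (hexp 0 t (by rwa [abs_of_pos ht0]))
  set ρ := m * Real.exp (-(t * d)) with hρ
  have hρ0 : 0 < ρ := by positivity
  obtain ⟨q, hq0, hq⟩ : ∃ q : ℝ, 0 < q ∧ (1 + q) * ρ < 1 := by
    refine ⟨(1 - ρ) / 2, by linarith, ?_⟩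
    nlinarith
  have hev : ∀ᶠ n in atTop, psiCoeff P X n ≤ ENNReal.ofReal q :=
    hmix.eventually_le_const (by simpa using hq0)
  obtain ⟨R, hR, hR1⟩ := (hev.and (eventually_ge_atTop 1)).exists
  set G : ℝ → ℝ≥0∞ := fun x => ENNReal.ofReal (Real.exp (t * F x)) with hG
  have hGm : Measurable G := (Real.measurable_exp.comp (hFm.const_mul t)).ennreal_ofReal
  have hGi : ∀ i, ∫⁻ ω, G (X i ω) ∂P ≤ ENNReal.ofReal m := by
    intro i
    rw [← lintegral_map hGm (hX i), hlaw i, lintegral_map hGm (hX 0), hm, mgf,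
      ofReal_integral_eq_lintegral_ofReal (hexp 0 t (by rwa [abs_of_pos ht0]))
        (ae_of_all _ fun _ => (Real.exp_pos _).le)]
  set ρ' := (1 + q) * ρ with hρ'
  have hρ'0 : 0 < ρ' := by positivity
  have hblock : ∀ K c, P.real {ω | d * K ≤ ∑ j ∈ Finset.range K, F (X (c + j * R) ω)}
      ≤ ρ' ^ K := by
    intro K c
    have h1 := lintegral_prod_le_of_psiCoeff_le hX hq0.le hR hGm hGi c K
    have h2 : ENNReal.ofReal (Real.exp (t * (d * K))) *
        P {ω | d * K ≤ ∑ j ∈ Finset.range K, F (X (c + j * R) ω)} ≤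
        (ENNReal.ofReal (1 + q) * ENNReal.ofReal m) ^ K := by
      refine le_trans ?_ h1
      refine le_trans ?_ (mul_meas_ge_le_lintegral (Finset.measurable_fun_prod _
        fun j _ => hGm.comp (hX _)) (ENNReal.ofReal (Real.exp (t * (d * K)))))
      gcongr
      intro hle
      simp only [hG, Function.comp_apply]
      rw [← ENNReal.ofReal_prod_of_nonneg fun _ _ => (Real.exp_pos _).le, ← Real.exp_sum,
        ← Finset.mul_sum]
      gcongr
    rw [← ENNReal.ofReal_mul (by positivity), ← ENNReal.ofReal_pow (by positivity),
      ← ofReal_measureReal, ← ENNReal.ofReal_mul (Real.exp_pos _).le,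
      ENNReal.ofReal_le_ofReal_iff (by positivity)] at h2
    have h3 : ρ' ^ K = Real.exp (-(t * (d * K))) * ((1 + q) * m) ^ K := by
      rw [hρ', hρ, ← mul_assoc, mul_pow, ← Real.exp_nat_mul, mul_comm]
      ring_nf
    rw [h3, Real.exp_neg, ← div_eq_inv_mul, le_div_iff₀ (Real.exp_pos _), mul_comm]
    exact h2
  -- From `N₀` on, `d * (N + R) ≤ D * N`, so rounding `N` up to a multiple of `R` is harmless.
  obtain ⟨N₀, hN₀⟩ := exists_nat_ge (d * R / (D - d))
  have hR0 : (0 : ℝ) < R := by exact_mod_cast hR1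
  refine ExpSmall.of_eventually (fun N => measureReal_le_one) (C := R) (c := -Real.log ρ' / R)
    (N₀ := N₀) (div_pos (neg_pos.2 (Real.log_neg hρ'0 hq)) hR0) fun N hN => ?_
  have hNlt : N < (N / R + 1) * R := by
    rw [mul_comm]; exact Nat.lt_mul_div_succ N hR1
  have hNle : (N / R + 1) * R ≤ N + R := by
    rw [add_mul, one_mul]; exact Nat.add_le_add_right (Nat.div_mul_le_self _ _) _
  have hNle' : (((N / R + 1 : ℕ) : ℝ)) * R ≤ N + R := by exact_mod_cast hNle
  have hNlt' : (N : ℝ) < ((N / R + 1 : ℕ) : ℝ) * R := by exact_mod_cast hNlt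
  refine (measureReal_sum_ge_le_mul (fun i ω => hF0 (X i ω)) hNlt.le ?_ hR1
    (hblock (N / R + 1))).trans ?_
  · have : d * R / (D - d) ≤ N := hN₀.trans (by exact_mod_cast hN)
    rw [div_le_iff₀ (by linarith)] at this
    nlinarith
  · gcongr
    rw [← Real.exp_log hρ'0, ← Real.exp_nat_mul, Real.exp_log hρ'0]
    apply Real.exp_le_exp.2
    have e : -(-Real.log ρ' / R * N) = Real.log ρ' * (N / R) := by ring
    rw [e, mul_comm]
    apply mul_le_mul_of_nonpos_left _ (Real.log_neg hρ'0 hq).le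
    rw [div_le_iff₀ hR0]
    exact hNlt'.le

end

section

/-! ### Weakly dependent sequences -/

theorem abs_exp_sub_exp_le {a b : ℝ} (ha : a ≤ 0) (hb : b ≤ 0) :
    |Real.exp a - Real.exp b| ≤ |a - b| := by
  wlog h : b ≤ a generalizing a b
  · rw [abs_sub_comm, abs_sub_comm a b]
    exact this hb ha (le_of_not_ge h)
  have h1 : Real.exp b = Real.exp a * Real.exp (b - a) := by rw [← Real.exp_add]; ring_nf
  have h2 := Real.add_one_le_exp (b - a)
  have h3 := Real.exp_le_one_iff.2 ha
  rw [abs_of_nonneg (sub_nonneg.2 (Real.exp_le_exp.2 h)), abs_of_nonneg (sub_nonneg.2 h), h1]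
  nlinarith [Real.exp_pos a]

/-- The exponential of `t * ∑ F (z a)` capped at the level `exp Q` and divided by `exp Q`. -/
noncomputable def cappedExp (F : ℝ → ℝ) (t Q : ℝ) (n : ℕ) (z : Fin n → ℝ) : ℝ :=
  Real.exp (min (t * ∑ a, F (z a)) Q - Q)

theorem cappedExp_nonneg (F : ℝ → ℝ) (t Q : ℝ) {n : ℕ} (z : Fin n → ℝ) :
    0 ≤ cappedExp F t Q n z := (Real.exp_pos _).le

theorem cappedExp_le_one (F : ℝ → ℝ) (t Q : ℝ) {n : ℕ} (z : Fin n → ℝ) :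
    cappedExp F t Q n z ≤ 1 :=
  Real.exp_le_one_iff.2 (sub_nonpos.2 (min_le_right _ _))

/-- Dividing by `exp Q` makes the exponent nonpositive, where `exp` is 1-Lipschitz. Hence the
constant depends neither on the cap nor on the number of variables. -/
theorem isLip_cappedExp {ℓ : NNReal} {F : ℝ → ℝ} (hF : LipschitzWith ℓ F) {t : ℝ} (ht : 0 ≤ t)
    (Q : ℝ) (n : ℕ) : IsLip (cappedExp F t Q n) (t * ℓ) := by
  refine ⟨by positivity, fun x y => ?_⟩
  refine (abs_exp_sub_exp_le (sub_nonpos.2 (min_le_right _ _))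
    (sub_nonpos.2 (min_le_right _ _))).trans ?_
  rw [sub_sub_sub_cancel_right]
  have h1 := abs_min_sub_min_le_max (t * ∑ a, F (x a)) Q (t * ∑ a, F (y a)) Q
  rw [sub_self, abs_zero, max_eq_left (abs_nonneg _)] at h1
  refine h1.trans ?_
  rw [← mul_sub, ← Finset.sum_sub_distrib, abs_mul, abs_of_nonneg ht, mul_assoc]
  gcongr
  refine (Finset.abs_sum_le_sum_abs _ _).trans ?_
  rw [Finset.mul_sum]
  exact Finset.sum_le_sum fun a _ => hF.dist_le_mul (x a) (y a)

theorem cappedExp_mem_lipClass {ℓ : NNReal} {F : ℝ → ℝ} (hF : LipschitzWith ℓ F) {t : ℝ}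
    (ht : 0 ≤ t) (Q : ℝ) (n : ℕ) : cappedExp F t Q n ∈ lipClass n :=
  ⟨fun z => by
    rw [abs_of_nonneg (cappedExp_nonneg F t Q z)]
    exact cappedExp_le_one F t Q z, _, isLip_cappedExp hF ht Q n⟩

theorem measurable_cappedExp {F : ℝ → ℝ} (hF : Measurable F) (t Q : ℝ) (n : ℕ) :
    Measurable (cappedExp F t Q n) := by
  unfold cappedExp
  fun_prop

variable {Ω : Type*} [MeasurableSpace Ω] {P : Measure Ω}

/-- Geometric covariance bounds for capped exponentials. -/
def HasCappedCovarianceDecay (P : Measure Ω) (X : ℕ → Ω → ℝ) (B a : ℝ) (p : ℕ) : Prop :=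
  ∀ (ℓ : NNReal) (F : ℝ → ℝ), LipschitzWith ℓ F → ∀ t : ℝ, 0 ≤ t → ∀ (Q : ℝ) (n r : ℕ), 1 ≤ n →
    ∀ (i : Fin n → ℕ) (j : Fin 1 → ℕ), Monotone i → (∀ a b, i a + r < j b) →
      |cov[fun ω => cappedExp F t Q n (fun a => X (i a) ω),
        fun ω => cappedExp F t Q 1 (fun b => X (j b) ω); P]|
        ≤ B * ((n : ℝ) + 1) ^ p * (1 + t * ℓ) ^ 2 * Real.exp (-(a * r))

/-- This is the only consequence of weak dependence used below: a block of the past tested against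
one later observation. -/
theorem IsWeaklyDependent.hasCappedCovarianceDecay {X : ℕ → Ω → ℝ}
    {L : (n : ℕ) → Set ((Fin n → ℝ) → ℝ)}
    {ψ : (n m : ℕ) → ((Fin n → ℝ) → ℝ) → ((Fin m → ℝ) → ℝ) → ℝ} {θ : ℕ → ℝ}
    (h : IsWeaklyDependent P X L ψ θ) (hL : IsAdmissible L ψ) (hθ : HasExpDecay θ) :
    ∃ B a : ℝ, ∃ p : ℕ, 0 ≤ B ∧ 0 < a ∧ HasCappedCovarianceDecay P X B a p := by
  obtain ⟨A', a, ha, hA'⟩ := hθ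
  obtain ⟨A, p, hA⟩ := hL.growth
  refine ⟨|A| * |A'|, a, p, by positivity, ha, fun ℓ F hF t ht Q n r hn i j hi hij => ?_⟩
  have hf := cappedExp_mem_lipClass hF ht Q n
  have hg := cappedExp_mem_lipClass hF ht Q 1
  refine (h.2 n 1 r hn le_rfl _ (hL.lipClass_subset _ hf) _ (hL.lipClass_subset _ hg) i j hi
    (fun x y _ => by rw [Subsingleton.elim x y]) hij).trans ?_
  have h1 := hA n 1 hn le_rfl _ hf _ hg _ _ (isLip_cappedExp hF ht Q n) (isLip_cappedExp hF ht Q 1)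
  have h2 : θ r ≤ |A'| * Real.exp (-(a * r)) := by
    rw [← neg_mul]
    exact (hA' r).trans (mul_le_mul_of_nonneg_right (le_abs_self _) (Real.exp_pos _).le)
  have h3 : ψ n 1 (cappedExp F t Q n) (cappedExp F t Q 1) ≤
      |A| * ((n : ℝ) + 1) ^ p * (1 + t * ℓ) ^ 2 := by
    refine h1.trans ?_
    rw [mul_assoc, ← sq, Nat.cast_one]
    gcongr
    exact le_abs_self A
  calc _ ≤ ψ n 1 (cappedExp F t Q n) (cappedExp F t Q 1) * (|A'| * Real.exp (-(a * r))) :=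
        mul_le_mul_of_nonneg_left h2 (hL.nonneg _ _ _ _)
    _ ≤ (|A| * ((n : ℝ) + 1) ^ p * (1 + t * ℓ) ^ 2) * (|A'| * Real.exp (-(a * r))) :=
        mul_le_mul_of_nonneg_right h3 (by positivity)
    _ = _ := by ring

variable [IsProbabilityMeasure P]

/-- For `u, v ≥ 0` one has `min (u + v) Q ≤ min u Q + min v Q`; the factor `exp Q` compensates for
normalizing twice on the right. -/
theorem cappedExp_succ_le {F : ℝ → ℝ} (hF : ∀ x, 0 ≤ F x) {t Q : ℝ} (ht : 0 ≤ t) (hQ : 0 ≤ Q)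
    (x : ℕ → ℝ) (n : ℕ) : cappedExp F t Q (n + 1) (fun a => x a) ≤
      Real.exp Q * (cappedExp F t Q n (fun a => x a) * cappedExp F t Q 1 (fun _ => x n)) := by
  unfold cappedExp
  rw [← Real.exp_add, ← Real.exp_add, Fin.sum_univ_castSucc]
  apply Real.exp_le_exp.2
  simp only [Fin.val_castSucc, Fin.val_last, Finset.univ_unique, Finset.sum_const,
    Finset.card_singleton, one_smul]
  have h1 : 0 ≤ t * ∑ a : Fin n, F (x a) := mul_nonneg ht (Finset.sum_nonneg fun _ _ => hF _)
  have h2 : 0 ≤ t * F (x n) := mul_nonneg ht (hF _)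
  rw [mul_add]
  rcases min_cases (t * ∑ a : Fin n, F (x a)) Q with ⟨h3, h4⟩ | ⟨h3, h4⟩ <;>
  rcases min_cases (t * F (x n)) Q with ⟨h5, h6⟩ | ⟨h5, h6⟩ <;>
  rcases min_cases (t * ∑ a : Fin n, F (x a) + t * F (x n)) Q with ⟨h7, h8⟩ | ⟨h7, h8⟩ <;>
  linarith

/-- The exponential moments of well separated observations factorize up to a small error. -/
theorem HasCappedCovarianceDecay.integral_cappedExp_le {X : ℕ → Ω → ℝ} {B a : ℝ} {p : ℕ}
    (hcov : HasCappedCovarianceDecay P X B a p) (hB : 0 ≤ B) (hX : ∀ i, Measurable (X i))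
    {ℓ : NNReal} {F : ℝ → ℝ} (hF : LipschitzWith ℓ F) (hF0 : ∀ x, 0 ≤ F x) {t : ℝ} (ht : 0 ≤ t)
    (hint : ∀ i, Integrable (fun ω => Real.exp (t * F (X i ω))) P) {m : ℝ} (hm1 : 1 ≤ m)
    (hm : ∀ i, ∫ ω, Real.exp (t * F (X i ω)) ∂P ≤ m) {Q : ℝ} (hQ0 : 0 ≤ Q) (r c K k : ℕ)
    (hk : k ≤ K) :
    Real.exp Q * ∫ ω, cappedExp F t Q k (fun b => X (c + b * (r + 1)) ω) ∂P ≤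
      m ^ k * (1 + k * (Real.exp (2 * Q) * (B * ((K : ℝ) + 1) ^ p * (1 + t * ℓ) ^ 2 *
        Real.exp (-(a * r))))) := by
  have hFm : Measurable F := hF.continuous.measurable
  set E := B * ((K : ℝ) + 1) ^ p * (1 + t * ℓ) ^ 2 * Real.exp (-(a * r)) with hE
  have hE0 : 0 ≤ E := by positivity
  have hmeas : ∀ (n : ℕ) (i : Fin n → ℕ),
      Measurable fun ω => cappedExp F t Q n (fun b => X (i b) ω) := fun n i =>
    (measurable_cappedExp hFm t Q n).comp (measurable_pi_lambda _ fun b => hX (i b))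
  have hbd : ∀ (n : ℕ) (i : Fin n → ℕ) ω, ‖cappedExp F t Q n (fun b => X (i b) ω)‖ ≤ 1 :=
    fun n i ω => by
      rw [Real.norm_eq_abs, abs_of_nonneg (cappedExp_nonneg _ _ _ _)]
      exact cappedExp_le_one _ _ _ _
  have hLp : ∀ (n : ℕ) (i : Fin n → ℕ) (q : ℝ≥0∞),
      MemLp (fun ω => cappedExp F t Q n (fun b => X (i b) ω)) q P := fun n i q =>
    .of_bound (hmeas n i).aestronglyMeasurable 1 (ae_of_all _ (hbd n i))
  have hone : ∀ i, Real.exp Q * ∫ ω, cappedExp F t Q 1 (fun _ => X i ω) ∂P ≤ m := by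
    intro i
    rw [← integral_const_mul]
    refine le_trans (integral_mono (((hLp 1 (fun _ => i) 1).integrable le_rfl).const_mul _)
      (hint i) fun ω => ?_) (hm i)
    simp only [cappedExp]
    rw [← Real.exp_add]
    apply Real.exp_le_exp.2
    simp
  induction k with
  | zero =>
    simp only [cappedExp, Finset.univ_eq_empty, Finset.sum_empty, mul_zero, integral_const,
      probReal_univ, one_smul, pow_zero, CharP.cast_eq_zero, zero_mul, add_zero, mul_one]
    rw [← Real.exp_add]
    apply Real.exp_le_one_iff.2
    have := min_le_left 0 Q
    linarith
  | succ k ih =>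
    have ih := ih (by omega)
    set u := ∫ ω, cappedExp F t Q k (fun b => X (c + b * (r + 1)) ω) ∂P
    set v := ∫ ω, cappedExp F t Q 1 (fun _ => X (c + k * (r + 1)) ω) ∂P
    have hu0 : 0 ≤ u := integral_nonneg fun ω => cappedExp_nonneg _ _ _ _
    have hstep : ∫ ω, cappedExp F t Q k (fun b => X (c + b * (r + 1)) ω) *
        cappedExp F t Q 1 (fun _ => X (c + k * (r + 1)) ω) ∂P ≤ u * v + E := by
      -- The covariance bound requires a nonempty past; for an empty one the first factor is
      -- constant.
      rcases Nat.eq_zero_or_pos k with rfl | hkpos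
      · have h0 : ∀ ω, cappedExp F t Q 0 (fun b => X (c + b * (r + 1)) ω) =
            Real.exp (min 0 Q - Q) := fun ω => by simp [cappedExp]
        simp only [u, v, h0, integral_const_mul, integral_const, probReal_univ, one_smul]
        linarith
      · have h1 := hcov ℓ F hF t ht Q k r hkpos (fun b => c + b * (r + 1))
          (fun _ => c + k * (r + 1)) (fun x y hxy => by
            have : (x : ℕ) ≤ y := hxy
            simp only
            gcongr) (fun x _ => by
            have h2 : ((x : ℕ) + 1) * (r + 1) ≤ k * (r + 1) := Nat.mul_le_mul_right _ x.2
            rw [add_mul, one_mul] at h2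
            omega)
        rw [covariance_eq_sub (hLp _ _ 2) (hLp _ _ 2)] at h1
        have h2 : B * ((k : ℝ) + 1) ^ p * (1 + t * ℓ) ^ 2 * Real.exp (-(a * r)) ≤ E := by
          have : (k : ℝ) ≤ K := by exact_mod_cast (by omega : k ≤ K)
          rw [hE]
          gcongr
        have h3 := (abs_le.1 (h1.trans h2)).2
        simp only [Pi.mul_apply] at h3
        linarith
    have hprod : ∫ ω, cappedExp F t Q (k + 1) (fun b => X (c + b * (r + 1)) ω) ∂P ≤
        Real.exp Q * ∫ ω, cappedExp F t Q k (fun b => X (c + b * (r + 1)) ω) *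
          cappedExp F t Q 1 (fun _ => X (c + k * (r + 1)) ω) ∂P := by
      rw [← integral_const_mul]
      refine integral_mono ((hLp _ _ 1).integrable le_rfl)
        (((hLp _ _ 2).integrable_mul (hLp _ _ 2)).const_mul _) fun ω => ?_
      exact cappedExp_succ_le hF0 ht hQ0 (fun b => X (c + b * (r + 1)) ω) k
    have hv := hone (c + k * (r + 1))
    have e2 : Real.exp (2 * Q) = Real.exp Q * Real.exp Q := by rw [← Real.exp_add]; ring_nf
    have hQ := Real.exp_pos Q
    set D := Real.exp (2 * Q) * E with hD
    have hD0 : 0 ≤ D := by positivity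
    have hmk : 1 ≤ m ^ (k + 1) := one_le_pow₀ hm1
    -- For `a_k = exp Q * u` this is the recursion `a_{k+1} ≤ m a_k + D`; since `m ≥ 1`, the new
    -- error `D` is at most `m ^ (k + 1) * D`.
    calc _ ≤ Real.exp Q * (Real.exp Q * (u * v + E)) := by
          gcongr
          exact hprod.trans (by gcongr)
      _ = (Real.exp Q * u) * (Real.exp Q * v) + D := by rw [hD, e2]; ring
      _ ≤ (Real.exp Q * u) * m + D := by gcongr
      _ ≤ (m ^ k * (1 + k * D)) * m + m ^ (k + 1) * D := by
          gcongr
          nlinarith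
      _ = _ := by push_cast; ring

/-- The chance that the mean of `K` well separated observations exceeds `d`. -/
theorem HasCappedCovarianceDecay.measureReal_sum_ge_le {X : ℕ → Ω → ℝ} {B a : ℝ} {p : ℕ}
    (hcov : HasCappedCovarianceDecay P X B a p) (hB : 0 ≤ B) (hX : ∀ i, Measurable (X i))
    {ℓ : NNReal} {F : ℝ → ℝ} (hF : LipschitzWith ℓ F) (hF0 : ∀ x, 0 ≤ F x) {t : ℝ} (ht : 0 ≤ t)
    (hint : ∀ i, Integrable (fun ω => Real.exp (t * F (X i ω))) P) {m : ℝ} (hm1 : 1 ≤ m)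
    (hm : ∀ i, ∫ ω, Real.exp (t * F (X i ω)) ∂P ≤ m) {d : ℝ} (hd : 0 ≤ d) (r c K : ℕ) :
    P.real {ω | d * K ≤ ∑ j ∈ Finset.range K, F (X (c + j * (r + 1)) ω)} ≤
      (m * Real.exp (-(t * d))) ^ K * (1 + K * (Real.exp (2 * (t * (d * K))) *
        (B * ((K : ℝ) + 1) ^ p * (1 + t * ℓ) ^ 2 * Real.exp (-(a * r))))) := by
  -- The cap is placed exactly at the deviation level, so on the event the capped exponential equals
  -- `1` and Markov's inequality at level `1` loses nothing.
  set Q := t * (d * K) with hQ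
  have h := hcov.integral_cappedExp_le hB hX hF hF0 ht hint hm1 hm (Q := Q) (by positivity) r c K K
    le_rfl
  set W := 1 + K * (Real.exp (2 * Q) *
    (B * ((K : ℝ) + 1) ^ p * (1 + t * ℓ) ^ 2 * Real.exp (-(a * r))))
  have hmeas : Measurable fun ω => cappedExp F t Q K (fun b => X (c + b * (r + 1)) ω) :=
    (measurable_cappedExp hF.continuous.measurable t Q K).comp
      (measurable_pi_lambda _ fun b => hX _)
  have hint' : Integrable (fun ω => cappedExp F t Q K (fun b => X (c + b * (r + 1)) ω)) P :=
    .of_bound hmeas.aestronglyMeasurable 1 (ae_of_all _ fun ω => by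
      rw [Real.norm_eq_abs, abs_of_nonneg (cappedExp_nonneg _ _ _ _)]
      exact cappedExp_le_one _ _ _ _)
  have h1 := mul_meas_ge_le_integral_of_nonneg
    (ae_of_all P fun ω => cappedExp_nonneg F t Q fun b : Fin K => X (c + b * (r + 1)) ω) hint' 1
  rw [one_mul] at h1
  have h2 : P.real {ω | d * K ≤ ∑ j ∈ Finset.range K, F (X (c + j * (r + 1)) ω)} ≤
      ∫ ω, cappedExp F t Q K (fun b => X (c + b * (r + 1)) ω) ∂P := by
    refine le_trans (measureReal_mono (fun ω hω => ?_) (measure_ne_top _ _)) h1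
    simp only [Set.mem_ofPred_eq] at hω ⊢
    rw [Finset.sum_range] at hω
    rw [cappedExp, min_eq_right, sub_self, Real.exp_zero]
    exact mul_le_mul_of_nonneg_left hω ht
  have e : (m * Real.exp (-(t * d))) ^ K = Real.exp (-Q) * m ^ K := by
    rw [mul_pow, ← Real.exp_nat_mul, mul_comm, hQ]
    ring_nf
  rw [e, mul_assoc, Real.exp_neg, ← div_eq_inv_mul, le_div_iff₀ (Real.exp_pos _), mul_comm]
  exact (mul_le_mul_of_nonneg_left h2 (Real.exp_pos _).le).trans h

end

/-! ### Balancing block length and gap under weak dependence. -/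

section

variable {Ω : Type*} [MeasurableSpace Ω] {P : Measure Ω} [IsProbabilityMeasure P]

theorem HasCappedCovarianceDecay.hasLipschitzDeviations {X : ℕ → Ω → ℝ} {B a : ℝ} {p : ℕ}
    (hcov : HasCappedCovarianceDecay P X B a p) (hB : 0 ≤ B) (ha : 0 < a)
    (hC : UniformCramer P X) (hX : ∀ i, Measurable (X i))
    (hlaw : ∀ i, P.map (X i) = P.map (X 0)) :
    HasLipschitzDeviations P X fun N => Real.sqrt N := by
  refine .of_nonneg hC hX fun ℓ F hF hF0 D hD => ?_
  have hFm : Measurable F := hF.continuous.measurable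
  have hmean : 0 ≤ ∫ ω, F (X 0 ω) ∂P := integral_nonneg fun ω => hF0 _
  obtain ⟨d, hd1, hd2⟩ := exists_between hD
  have hd0 : 0 < d := hmean.trans_lt hd1
  obtain ⟨s, hs, hexp⟩ := hC.exists_integrable_exp_lipschitz hX hF
  obtain ⟨t, ht0, hta, hts, ht⟩ := exists_mgf_mul_exp_lt_one hs (hexp 0) hd1
    -- With `K ≤ r + 1` this gives `2 t d K ≤ a (r + 1) / 2`: the cap consumes only half of the
    -- decay `exp (-a r)`.
    (τ := a / (4 * d)) (by positivity)
  rw [lt_div_iff₀ (by positivity)] at hta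
  have hint : ∀ i, Integrable (fun ω => Real.exp (t * F (X i ω))) P :=
    fun i => hexp i t (by rwa [abs_of_pos ht0])
  set m := mgf (fun ω => F (X 0 ω)) P t with hm
  have hm1 : 1 ≤ m := by
    calc (1 : ℝ) = ∫ _ω, (1 : ℝ) ∂P := by simp
      _ ≤ m := integral_mono (integrable_const _) (hint 0) fun ω =>
        Real.one_le_exp (mul_nonneg ht0.le (hF0 _))
  have hmi : ∀ i, ∫ ω, Real.exp (t * F (X i ω)) ∂P ≤ m := by
    intro i
    have hG : Measurable fun x => Real.exp (t * F x) :=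
      Real.measurable_exp.comp (hFm.const_mul t)
    rw [hm, mgf, ← integral_map (hX i).aemeasurable hG.aestronglyMeasurable, hlaw i,
      integral_map (hX 0).aemeasurable hG.aestronglyMeasurable]
  set ρ := m * Real.exp (-(t * d)) with hρ
  have hρ0 : 0 < ρ := by positivity
  obtain ⟨C₁, hC₁, hC₁'⟩ := exists_pow_mul_exp_le (p + 1) (b := a / 2) (by positivity)
  have hlog : Real.log ρ < 0 := Real.log_neg hρ0 ht
  -- Half of the exponent of `ρ ^ r` is spent on the number `r + 1` of residue classes; the other
  -- half survives as the final rate.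
  obtain ⟨C₂, hC₂, hC₂'⟩ := exists_pow_mul_exp_le 1 (b := -Real.log ρ / 2) (by linarith)
  set W := 1 + Real.exp (a / 2) * B * (1 + t * ℓ) ^ 2 * C₁ with hW
  have hW0 : 0 ≤ W := by positivity
  obtain ⟨N₁, hN₁⟩ := exists_nat_ge (d * 2 / (D - d))
  refine ExpSmall.of_eventually (fun N => measureReal_le_one)
    (C := C₂ * W * Real.exp (-Real.log ρ / 2)) (c := -Real.log ρ / 2)
    (N₀ := N₁ ^ 2 + 1) (by linarith) fun N hN => ?_
  set r := Nat.sqrt N with hr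
  have hr1 : r * r ≤ N := Nat.sqrt_le N
  have hr2 : N < (r + 1) * (r + 1) := Nat.lt_succ_sqrt N
  have hrN₁ : N₁ ≤ r := Nat.le_sqrt'.2 (by omega)
  have hrpos : 1 ≤ r := Nat.le_sqrt'.2 (by omega)
  set K := N / (r + 1) + 1 with hK
  have hNlt : N < K * (r + 1) := by
    rw [hK, mul_comm]; exact Nat.lt_mul_div_succ N (Nat.succ_pos r)
  have hNle : K * (r + 1) ≤ N + (r + 1) := by
    rw [hK, add_mul, one_mul]; exact Nat.add_le_add_right (Nat.div_mul_le_self _ _) _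
  have hKle : K ≤ r + 1 := by
    have := Nat.div_lt_of_lt_mul hr2
    omega
  -- If `K ≤ r - 1`, then `N < K (r + 1) ≤ r² - 1`, contrary to `r² ≤ N`.
  have hrK : r ≤ K := by
    by_contra hcon
    have h1 : K * (r + 1) ≤ (r - 1) * (r + 1) := Nat.mul_le_mul_right _ (by omega)
    obtain ⟨r', hr'⟩ : ∃ r', r = r' + 1 := ⟨r - 1, by omega⟩
    rw [hr'] at h1 hr1 hNlt
    simp only [Nat.add_sub_cancel] at h1
    nlinarith
  have hKr : (K : ℝ) ≤ r + 1 := by exact_mod_cast hKle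
  have hblock : ∀ c, P.real {ω | d * K ≤ ∑ j ∈ Finset.range K, F (X (c + j * (r + 1)) ω)} ≤
      ρ ^ r * W := by
    intro c
    refine (hcov.measureReal_sum_ge_le hB hX hF hF0 ht0.le hint hm1 hmi hd0.le r c K).trans ?_
    apply mul_le_mul (pow_le_pow_of_le_one hρ0.le ht.le hrK) _ (by positivity) (by positivity)
    have h1 : Real.exp (2 * (t * (d * K))) * Real.exp (-(a * r)) ≤
        Real.exp (a / 2) * Real.exp (-(a / 2 * r)) := by
      rw [← Real.exp_add, ← Real.exp_add]
      apply Real.exp_le_exp.2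
      have : (t * (4 * d)) * K ≤ a * (r + 1) := by gcongr
      linarith
    have h2 : (K : ℝ) * ((K : ℝ) + 1) ^ p ≤ ((r : ℝ) + 2) ^ (p + 1) := by
      rw [pow_succ']
      exact mul_le_mul (by linarith) (pow_le_pow_left₀ (by positivity) (by linarith) _)
        (by positivity) (by positivity)
    rw [hW]
    refine add_le_add le_rfl ?_
    calc (K : ℝ) * (Real.exp (2 * (t * (d * K))) *
          (B * ((K : ℝ) + 1) ^ p * (1 + t * ℓ) ^ 2 * Real.exp (-(a * r))))
        = (B * (1 + t * ℓ) ^ 2) * ((K : ℝ) * ((K : ℝ) + 1) ^ p) *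
          (Real.exp (2 * (t * (d * K))) * Real.exp (-(a * r))) := by ring
      _ ≤ (B * (1 + t * ℓ) ^ 2) * ((r : ℝ) + 2) ^ (p + 1) *
          (Real.exp (a / 2) * Real.exp (-(a / 2 * r))) := by gcongr
      _ = Real.exp (a / 2) * B * (1 + t * ℓ) ^ 2 *
          (((r : ℝ) + 2) ^ (p + 1) * Real.exp (-(a / 2 * r))) := by ring
      _ ≤ _ := by
          gcongr
          exact hC₁' r
  have hNle' : (K : ℝ) * ((r : ℝ) + 1) ≤ N + (r + 1) := by exact_mod_cast hNle
  have hNr : (r : ℝ) * r ≤ N := by exact_mod_cast hr1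
  have hrpos' : (1 : ℝ) ≤ r := by exact_mod_cast hrpos
  have hsqrt : Real.sqrt N ≤ r + 1 := by
    rw [Real.sqrt_le_left (by positivity), sq]
    exact_mod_cast hr2.le
  refine (measureReal_sum_ge_le_mul (fun i ω => hF0 (X i ω)) hNlt.le ?_ (Nat.succ_pos r)
    hblock).trans ?_
  · have h1 : d * 2 / (D - d) ≤ r := hN₁.trans (by exact_mod_cast hrN₁)
    rw [div_le_iff₀ (by linarith)] at h1
    push_cast
    have h2 : d * (r + 1) ≤ (D - d) * N := by
      calc d * (r + 1) ≤ (d * 2) * r := by nlinarith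
        _ ≤ (r * (D - d)) * r := by gcongr
        _ = (D - d) * (r * r) := by ring
        _ ≤ _ := by
            have : 0 ≤ D - d := by linarith
            gcongr
    nlinarith
  · have h1 : ρ ^ r = Real.exp (-(-Real.log ρ / 2 * r)) * Real.exp (-(-Real.log ρ / 2 * r)) := by
      rw [← Real.exp_add, ← Real.exp_log hρ0, ← Real.exp_nat_mul, Real.exp_log hρ0]
      ring_nf
    have h2 := hC₂' r
    rw [pow_one] at h2
    have h3 : Real.exp (-(-Real.log ρ / 2 * r)) ≤
        Real.exp (-Real.log ρ / 2) * Real.exp (-(-Real.log ρ / 2 * Real.sqrt N)) := by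
      rw [← Real.exp_add]
      apply Real.exp_le_exp.2
      nlinarith
    calc ((r + 1 : ℕ) : ℝ) * (ρ ^ r * W)
        ≤ ((r : ℝ) + 2) * (ρ ^ r * W) := by
          push_cast
          gcongr
          norm_num
      _ = (((r : ℝ) + 2) * Real.exp (-(-Real.log ρ / 2 * r))) * W *
            Real.exp (-(-Real.log ρ / 2 * r)) := by rw [h1]; ring
      _ ≤ C₂ * W * (Real.exp (-Real.log ρ / 2) *
            Real.exp (-(-Real.log ρ / 2 * Real.sqrt N))) := by gcongr
      _ = _ := by ring

end

section

/-! ### The truncated identity and its Lipschitz approximations -/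

/-- The identity, set to zero outside `(-b, b)`. -/
noncomputable def cutoff (b y : ℝ) : ℝ := if |y| < b then y else 0

/-- A tent of height one and slope `n` around the points `b` and `-b`. -/
noncomputable def tent (b : ℝ) (n : ℕ) (y : ℝ) : ℝ := max (1 - n * |(|y| - b)|) 0

/-- The identity, clipped to an interval that shrinks to `{0}` as `|y|` approaches `b`. -/
noncomputable def softCutoff (b : ℝ) (n : ℕ) (y : ℝ) : ℝ :=
  max (-(n * b * max (b - |y|) 0)) (min (n * b * max (b - |y|) 0) y)

theorem exists_lipschitzWith_tent (b : ℝ) (n : ℕ) : ∃ ℓ : NNReal, LipschitzWith ℓ (tent b n) := by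
  refine ⟨n, LipschitzWith.max_const (LipschitzWith.of_dist_le_mul fun x y => ?_) 0⟩
  rw [Real.dist_eq, Real.dist_eq, sub_sub_sub_cancel_left, ← mul_sub, abs_mul]
  simp only [Nat.abs_cast, NNReal.coe_natCast]
  refine mul_le_mul_of_nonneg_left ?_ n.cast_nonneg
  refine (abs_abs_sub_abs_le (|y| - b) (|x| - b)).trans ?_
  rw [sub_sub_sub_cancel_right, abs_sub_comm x y]
  exact abs_abs_sub_abs_le y x

theorem exists_lipschitzWith_softCutoff {b : ℝ} (hb : 0 ≤ b) (n : ℕ) :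
    ∃ ℓ : NNReal, LipschitzWith ℓ (softCutoff b n) := by
  have h1 : LipschitzWith (Real.toNNReal (n * b)) fun y : ℝ => n * b * max (b - |y|) 0 := by
    refine LipschitzWith.of_dist_le_mul fun x y => ?_
    rw [Real.dist_eq, Real.dist_eq, ← mul_sub, abs_mul, abs_of_nonneg (by positivity : 0 ≤ n * b)]
    rw [Real.coe_toNNReal _ (by positivity)]
    refine mul_le_mul_of_nonneg_left ?_ (by positivity)
    have h2 := abs_max_sub_max_le_max (b - |x|) 0 (b - |y|) 0
    rw [sub_self, abs_zero, max_eq_left (abs_nonneg ((b - |x|) - (b - |y|))), sub_sub_sub_cancel_left,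
      abs_sub_comm |y|] at h2
    exact h2.trans (abs_abs_sub_abs_le x y)
  exact ⟨_, h1.neg.max (h1.min LipschitzWith.id)⟩

theorem tent_nonneg (b : ℝ) (n : ℕ) (y : ℝ) : 0 ≤ tent b n y := le_max_right _ _

theorem tent_le_one (b : ℝ) (n : ℕ) (y : ℝ) : tent b n y ≤ 1 :=
  max_le (sub_le_self _ (by positivity)) zero_le_one

/-- Inside `(-b, b)` clipping at `w = n b (b - |y|)` loses at most `b - w = b (1 - n (b - |y|))`
when it acts at all; outside, both functions vanish. -/
theorem abs_cutoff_sub_softCutoff_le {b : ℝ} (hb : 0 ≤ b) (n : ℕ) (y : ℝ) :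
    |cutoff b y - softCutoff b n y| ≤ b * tent b n y := by
  have ht := mul_nonneg hb (tent_nonneg b n y)
  unfold cutoff softCutoff
  split_ifs with h
  · have e : max (b - |y|) 0 = b - |y| := max_eq_left (by linarith)
    have ht2 : b * (1 - n * (b - |y|)) ≤ b * tent b n y := by
      gcongr
      rw [tent, abs_sub_comm, abs_of_pos (by linarith : 0 < b - |y|)]
      exact le_max_left _ _
    have h0 : 0 ≤ n * b * (b - |y|) := mul_nonneg (by positivity) (by linarith)
    have h3 : n * b * (b - |y|) = b - b * (1 - n * (b - |y|)) := by ring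
    have h5 := abs_lt.1 h
    rw [e, abs_le]
    rcases min_cases (n * b * (b - |y|)) y with ⟨h1, h1'⟩ | ⟨h1, h1'⟩ <;>
    rcases max_cases (-(n * b * (b - |y|))) (min (n * b * (b - |y|)) y) with ⟨h2, h2'⟩ | ⟨h2, h2'⟩ <;>
    constructor <;> linarith
  · have e : max (b - |y|) 0 = 0 := max_eq_right (by linarith)
    rw [e, mul_zero, neg_zero]
    have : max 0 (min 0 y) = 0 := max_eq_left (min_le_left _ _)
    rwa [this, sub_zero, abs_zero]

theorem tendsto_tent {b y : ℝ} (h : |y| ≠ b) :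
    Tendsto (fun n => tent b n y) atTop (𝓝 0) := by
  have hpos : 0 < |(|y| - b)| := abs_pos.2 (sub_ne_zero.2 h)
  obtain ⟨n₀, hn₀⟩ := exists_nat_ge (1 / |(|y| - b)|)
  refine tendsto_const_nhds.congr' ?_
  filter_upwards [eventually_ge_atTop n₀] with n hn
  have h1 : 1 / |(|y| - b)| ≤ n := hn₀.trans (by exact_mod_cast hn)
  rw [div_le_iff₀ hpos] at h1
  rw [tent, max_eq_right (by linarith)]

/-- `Ψ_N(b)` is the mean of the truncated centred observations. -/
theorem samplePsi_eq (x : ℕ → ℝ) (S : Finset ℕ) (b : ℝ) :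
    samplePsi x S b = (∑ i ∈ S, cutoff b (x i - sampleMean x S)) / S.card := by
  classical
  rcases S.eq_empty_or_nonempty with rfl | hS
  · simp [samplePsi]
  have hc : (S.card : ℝ) ≠ 0 := by exact_mod_cast hS.card_pos.ne'
  have hsub : ordinary x S b ⊆ S := Finset.filter_subset _ _
  have h1 : ∑ i ∈ S, cutoff b (x i - sampleMean x S) =
      ∑ i ∈ ordinary x S b, (x i - sampleMean x S) := by
    unfold cutoff ordinary
    rw [Finset.sum_filter]
  have h2 : ∑ i ∈ abnormal x S b, x i = ∑ i ∈ S, x i - ∑ i ∈ ordinary x S b, x i := by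
    rw [abnormal, ← Finset.sum_sdiff hsub, add_sub_cancel_right]
  have h3 : ((abnormal x S b).card : ℝ) = S.card - (ordinary x S b).card := by
    rw [abnormal, Finset.card_sdiff_of_subset hsub, Nat.cast_sub (Finset.card_le_card hsub)]
  have h4 : ∑ i ∈ S, x i = sampleMean x S * S.card := by
    rw [sampleMean, div_mul_cancel₀ _ hc]
  -- With `S₁` the ordinary sum, the numerator `(N - N₁) S₁ - N₁ (N θ - S₁)` collapses to `N (S₁ -
  -- N₁ θ)`.
  rw [samplePsi, h1, h2, h3, h4, Finset.sum_sub_distrib, Finset.sum_const, nsmul_eq_mul]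
  field_simp
  ring

/-- The content is boundedness in `b`, without which the real `sSup` carries no information; the
mean of `|x_i - θ|` is a bound. -/
theorem abs_samplePsi_le_maxSamplePsi (x : ℕ → ℝ) (S : Finset ℕ) {κ K b : ℝ}
    (hb : b ∈ Set.Icc κ K) : |samplePsi x S b| ≤ maxSamplePsi x S κ K := by
  refine le_csSup ?_ ⟨b, hb, rfl⟩
  refine ⟨(∑ i ∈ S, |x i - sampleMean x S|) / S.card, ?_⟩
  rintro _ ⟨b', -, rfl⟩
  simp only
  rw [samplePsi_eq, abs_div, Nat.abs_cast]
  gcongr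
  refine (Finset.abs_sum_le_sum_abs _ _).trans (Finset.sum_le_sum fun i _ => ?_)
  unfold cutoff
  split_ifs
  · exact le_rfl
  · rw [abs_zero]; exact abs_nonneg _

/-- Deterministic comparison of `Ψ_N(b)` with its limit. -/
theorem abs_samplePsi_sub_le {x : ℕ → ℝ} {N : ℕ} (hN : 1 ≤ N) {b : ℝ} (hb : 0 ≤ b) {n : ℕ}
    {ℓ ℓ' : NNReal} (hsoft : LipschitzWith ℓ (softCutoff b n)) (htent : LipschitzWith ℓ' (tent b n))
    {H η G e τ : ℝ} (hθ : |sampleMean x (Finset.range N) - H| ≤ η)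
    (hG : |∑ i ∈ Finset.range N, softCutoff b n (x i - H) - G * N| ≤ e * N)
    (hτ : ∑ i ∈ Finset.range N, tent b n (x i - H) ≤ τ * N) :
    |samplePsi x (Finset.range N) b - G| ≤ b * (τ + ℓ' * η) + ℓ * η + e := by
  have hN0 : (0 : ℝ) < N := by exact_mod_cast hN
  rw [samplePsi_eq, Finset.card_range]
  set θ := sampleMean x (Finset.range N)
  have hpt : ∀ i, |cutoff b (x i - θ) - softCutoff b n (x i - H)| ≤
      b * (tent b n (x i - H) + ℓ' * η) + ℓ * η := by
    intro i
    have hd : |(x i - θ) - (x i - H)| ≤ η := by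
      rwa [sub_sub_sub_cancel_left, abs_sub_comm]
    have h1 := abs_cutoff_sub_softCutoff_le hb n (x i - θ)
    have h2 := hsoft.dist_le_mul (x i - θ) (x i - H)
    have h3 := htent.dist_le_mul (x i - θ) (x i - H)
    rw [Real.dist_eq, Real.dist_eq] at h2 h3
    have h4 : (ℓ : ℝ) * |(x i - θ) - (x i - H)| ≤ ℓ * η := by gcongr
    have h5 : (ℓ' : ℝ) * |(x i - θ) - (x i - H)| ≤ ℓ' * η := by gcongr
    have h6 : tent b n (x i - θ) ≤ tent b n (x i - H) + ℓ' * η := by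
      linarith [(abs_le.1 h3).2]
    have h7 := mul_le_mul_of_nonneg_left h6 hb
    have h8 := abs_sub_le (cutoff b (x i - θ)) (softCutoff b n (x i - θ)) (softCutoff b n (x i - H))
    linarith
  have hsum : |∑ i ∈ Finset.range N, cutoff b (x i - θ) -
      ∑ i ∈ Finset.range N, softCutoff b n (x i - H)| ≤ (b * (τ + ℓ' * η) + ℓ * η) * N := by
    rw [← Finset.sum_sub_distrib]
    refine (Finset.abs_sum_le_sum_abs _ _).trans ((Finset.sum_le_sum fun i _ => hpt i).trans ?_)
    rw [Finset.sum_add_distrib, ← Finset.mul_sum, Finset.sum_add_distrib]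
    simp only [Finset.sum_const, Finset.card_range, nsmul_eq_mul]
    nlinarith [mul_le_mul_of_nonneg_left hτ hb]
  have e1 : (∑ i ∈ Finset.range N, cutoff b (x i - θ)) / N - G =
      (∑ i ∈ Finset.range N, cutoff b (x i - θ) - G * N) / N := by
    field_simp
  rw [e1, abs_div, Nat.abs_cast, div_le_iff₀ hN0]
  have h8 := abs_sub_le (∑ i ∈ Finset.range N, cutoff b (x i - θ))
    (∑ i ∈ Finset.range N, softCutoff b n (x i - H)) (G * N)
  linarith

/-! ### From deviation bounds to the first step of the procedure. -/

variable {Ω : Type*} [MeasurableSpace Ω] {P : Measure Ω} [IsProbabilityMeasure P]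

theorem HasLipschitzDeviations.expSmall_ge {X : ℕ → Ω → ℝ} {rate : ℕ → ℝ}
    (h : HasLipschitzDeviations P X rate) (hr : ∀ N, 0 ≤ rate N) {ℓ : NNReal} {F : ℝ → ℝ}
    (hF : LipschitzWith ℓ F) {e : ℝ} (he : 0 < e) :
    ExpSmall rate fun N => P.real
      {ω | e * N ≤ |∑ i ∈ Finset.range N, F (X i ω) - (∫ ω, F (X 0 ω) ∂P) * N|} := by
  set m := ∫ ω, F (X 0 ω) ∂P
  have h1 := h ℓ F hF (m + e) (by linarith)
  have h2 := h ℓ (fun x => -F x) hF.neg (-m + e) (by rw [integral_neg]; linarith)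
  refine (h1.add hr h2).mono fun N _ => ?_
  refine (measureReal_mono (fun ω hω => ?_) (measure_ne_top _ _)).trans (measureReal_union_le _ _)
  simp only [Set.mem_ofPred_eq, Set.mem_union, Finset.sum_neg_distrib] at hω ⊢
  rcases le_abs.1 hω with h3 | h3
  · left; linarith
  · right; linarith

/-- The probability of stopping at the first step is exponentially small if the threshold is smaller
than `|Ψ(b)|` for some `b`. -/
theorem HasLipschitzDeviations.expSmall_type2Error {X : ℕ → Ω → ℝ} {rate : ℕ → ℝ}
    (h : HasLipschitzDeviations P X rate) (hr : ∀ N, 0 ≤ rate N) (hC : UniformCramer P X)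
    (hX : ∀ i, Measurable (X i)) (hatom : ∀ c, ∀ᵐ ω ∂P, X 0 ω ≠ c) {κ K b C : ℝ}
    (hb : b ∈ Set.Icc κ K) (hb0 : 0 < b)
    (hlt : C < |∫ ω, cutoff b (X 0 ω - ∫ ω, X 0 ω ∂P) ∂P|) :
    ExpSmall rate fun N => P.real (type2Error X κ K C N) := by
  set H := ∫ ω, X 0 ω ∂P
  set G := ∫ ω, cutoff b (X 0 ω - H) ∂P
  set Δ := |G| - C with hΔ
  have hΔ0 : 0 < Δ := sub_pos.2 hlt
  have hshift : ∀ {ℓ : NNReal} {F : ℝ → ℝ}, LipschitzWith ℓ F → LipschitzWith ℓ fun x => F (x - H) :=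
    fun hF x y => by simpa [edist_sub_right] using hF (x - H) (y - H)
  have hlim : Tendsto (fun n => ∫ ω, tent b n (X 0 ω - H) ∂P) atTop (𝓝 0) := by
    rw [← integral_zero Ω ℝ (μ := P)]
    refine tendsto_integral_of_dominated_convergence (fun _ => (1 : ℝ)) (fun n => ?_)
      (integrable_const _) (fun n => ae_of_all _ fun ω => ?_) ?_
    · obtain ⟨ℓ, hℓ⟩ := exists_lipschitzWith_tent b n
      exact (hC.integrable_lipschitz hX (hshift hℓ) 0).aestronglyMeasurable
    · rw [Real.norm_eq_abs, abs_of_nonneg (tent_nonneg _ _ _)]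
      exact tent_le_one _ _ _
    · filter_upwards [hatom (H + b), hatom (H - b)] with ω h1 h2
      refine tendsto_tent fun h3 => ?_
      rcases (abs_eq hb0.le).1 h3 with h4 | h4
      · exact h1 (by linarith)
      · exact h2 (by linarith)
  obtain ⟨n, hn⟩ := (hlim.eventually_lt_const (show 0 < Δ / (8 * b) by positivity)).exists
  rw [lt_div_iff₀ (by positivity)] at hn
  obtain ⟨ℓ', htent⟩ := exists_lipschitzWith_tent b n
  obtain ⟨ℓ, hsoft⟩ := exists_lipschitzWith_softCutoff hb0.le n
  set τ := ∫ ω, tent b n (X 0 ω - H) ∂P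
  set G' := ∫ ω, softCutoff b n (X 0 ω - H) ∂P
  have hGG : |G' - G| ≤ b * τ := by
    have hsi := hC.integrable_lipschitz hX (hshift hsoft) 0
    have hti := hC.integrable_lipschitz hX (hshift htent) 0
    have hcm : Measurable (cutoff b) :=
      Measurable.ite (measurableSet_lt measurable_id.abs measurable_const) measurable_id
        measurable_const
    have hci : Integrable (fun ω => cutoff b (X 0 ω - H)) P := by
      refine .of_bound (hcm.comp ((hX 0).sub_const H)).aestronglyMeasurable b
        (ae_of_all _ fun ω => ?_)
      rw [Real.norm_eq_abs, cutoff]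
      split_ifs with h1
      · exact h1.le
      · rw [abs_zero]; exact hb0.le
    rw [← integral_sub hsi hci, ← integral_const_mul]
    refine (abs_integral_le_integral_abs).trans
      (integral_mono (hsi.sub hci).abs (hti.const_mul b) fun ω => ?_)
    simp only
    rw [abs_sub_comm]
    exact abs_cutoff_sub_softCutoff_le hb0.le n _
  -- The error splits into `2 b τ`, `e (1 + b)` and `η (b ℓ' + ℓ)`, together below `Δ / 2`, whereas
  -- a type 2 error would require at least `Δ`.
  obtain ⟨e, he0, he⟩ : ∃ e : ℝ, 0 < e ∧ e * (1 + b) = Δ / 8 :=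
    ⟨Δ / 8 / (1 + b), by positivity, by field_simp⟩
  obtain ⟨η, hη0, hη⟩ : ∃ η : ℝ, 0 < η ∧ η * (b * ℓ' + ℓ + 1) = Δ / 8 :=
    ⟨Δ / 8 / (b * ℓ' + ℓ + 1), by positivity, by field_simp⟩
  have d1 := h.expSmall_ge hr LipschitzWith.id hη0
  have d2 := h.expSmall_ge hr (hshift hsoft) he0
  have d3 := h.expSmall_ge hr (hshift htent) he0
  refine ((d1.add hr d2).add hr d3).mono fun N hN => ?_
  refine le_trans (measureReal_mono (fun ω hω => ?_) (measure_ne_top _ _))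
    ((measureReal_union_le _ _).trans (add_le_add (measureReal_union_le _ _) le_rfl))
  by_contra hcon
  simp only [Set.mem_union, Set.mem_ofPred_eq, not_or, not_le, id] at hcon
  obtain ⟨⟨c1, c2⟩, c3⟩ := hcon
  have hN0 : (0 : ℝ) < N := by exact_mod_cast hN
  rw [mem_type2Error] at hω
  have hω := (abs_samplePsi_le_maxSamplePsi _ _ hb).trans hω
  have hθ : |sampleMean (fun i => X i ω) (Finset.range N) - H| ≤ η := by
    have e1 : sampleMean (fun i => X i ω) (Finset.range N) - H =
        (∑ i ∈ Finset.range N, X i ω - H * N) / N := by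
      rw [sampleMean, Finset.card_range]
      field_simp
    rw [e1, abs_div, Nat.abs_cast, div_le_iff₀ hN0]
    exact c1.le
  have hfin := abs_samplePsi_sub_le hN hb0.le hsoft htent (x := fun i => X i ω) (τ := τ + e) hθ c2.le
    (by linarith [(abs_lt.1 c3).2])
  have h1 := abs_sub_abs_le_abs_sub G (samplePsi (fun i => X i ω) (Finset.range N) b)
  have h2 := abs_sub_le (samplePsi (fun i => X i ω) (Finset.range N) b) G' G
  rw [abs_sub_comm G] at h1
  nlinarith

end

section

/-! ### The mixture density -/

theorem isDensityWithMean_mixture {k : ℕ} {f₀ : ℝ → ℝ} {f : Fin k → ℝ → ℝ} {h ε : Fin k → ℝ}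
    (hf₀ : IsDensityWithMean f₀ 0) (hf : ∀ j, IsDensityWithMean (f j) (h j)) (hε : ∀ j, 0 ≤ ε j)
    (hε_sum : ∑ j, ε j < 1) :
    IsDensityWithMean (mixtureDensity f₀ f ε) (mixtureMean ε h) := by
  have e : (fun x => x * mixtureDensity f₀ f ε x) =
      fun x => (1 - ∑ j, ε j) * (x * f₀ x) + ∑ j, ε j * (x * f j x) := by
    funext x
    rw [mixtureDensity, mul_add, Finset.mul_sum]
    congr 1
    · ring
    · exact Finset.sum_congr rfl fun j _ => by ring
  have i1 : Integrable fun x => (1 - ∑ j, ε j) * f₀ x := hf₀.integrable.const_mul _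
  have i2 : ∀ j ∈ Finset.univ, Integrable fun x => ε j * f j x :=
    fun j _ => (hf j).integrable.const_mul _
  have i3 : Integrable fun x => (1 - ∑ j, ε j) * (x * f₀ x) := hf₀.integrable_mul.const_mul _
  have i4 : ∀ j ∈ Finset.univ, Integrable fun x => ε j * (x * f j x) :=
    fun j _ => (hf j).integrable_mul.const_mul _
  refine ⟨?_, fun x => ?_, ?_, ?_, ?_, ?_⟩
  · exact (hf₀.measurable.const_mul _).add
      (Finset.measurable_fun_sum _ fun j _ => (hf j).measurable.const_mul _)
  · exact add_nonneg (mul_nonneg (by linarith) (hf₀.nonneg x))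
      (Finset.sum_nonneg fun j _ => mul_nonneg (hε j) ((hf j).nonneg x))
  · exact i1.add (integrable_finsetSum _ i2)
  · simp only [mixtureDensity]
    rw [integral_add i1 (integrable_finsetSum _ i2), integral_finsetSum _ i2]
    simp only [integral_const_mul, hf₀.integral_eq_one, (hf _).integral_eq_one, mul_one]
    ring
  · rw [e]
    exact i3.add (integrable_finsetSum _ i4)
  · rw [e, integral_add i3 (integrable_finsetSum _ i4), integral_finsetSum _ i4]
    simp only [integral_const_mul, hf₀.mean_eq, (hf _).mean_eq, mul_zero, zero_add, mixtureMean]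

/-- Population counterpart of `samplePsi_eq`. The strict inequality in `cutoff` gives an open
interval, which differs from the half-open one by a null set. -/
theorem limitPsi_eq_integral_cutoff {g : ℝ → ℝ} {H : ℝ} (hg : IsDensityWithMean g H) {b : ℝ}
    (hb : 0 ≤ b) : limitPsi g H b = ∫ x, cutoff b (x - H) * g x := by
  have e : (fun x => cutoff b (x - H) * g x) =
      (Set.Ioo (H - b) (H + b)).indicator fun x => x * g x - H * g x := by
    funext x
    by_cases hx : x ∈ Set.Ioo (H - b) (H + b)
    · rw [Set.indicator_of_mem hx, cutoff, if_pos (abs_lt.2 ⟨by linarith [hx.1], by linarith [hx.2]⟩)]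
      ring
    · rw [Set.indicator_of_notMem hx, cutoff, if_neg, zero_mul]
      intro h
      have := abs_lt.1 h
      exact hx ⟨by linarith, by linarith⟩
  rw [e, integral_indicator measurableSet_Ioo, ← integral_Ioc_eq_integral_Ioo,
    integral_sub hg.integrable_mul.integrableOn (hg.integrable.const_mul H).integrableOn,
    integral_const_mul, limitPsi, intervalIntegral.integral_of_le (by linarith),
    intervalIntegral.integral_of_le (by linarith)]

variable {Ω : Type*} [MeasurableSpace Ω] {P : Measure Ω}

theorem integral_comp_eq_integral_mul {Y : Ω → ℝ} (hY : Measurable Y) {g : ℝ → ℝ} {H : ℝ}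
    (hg : IsDensityWithMean g H)
    (hlaw : P.map Y = volume.withDensity fun x => ENNReal.ofReal (g x)) {F : ℝ → ℝ}
    (hF : Measurable F) : ∫ ω, F (Y ω) ∂P = ∫ x, F x * g x := by
  rw [← integral_map hY.aemeasurable hF.aestronglyMeasurable, hlaw,
    integral_withDensity_eq_integral_toReal_smul hg.measurable.ennreal_ofReal
      (ae_of_all _ fun x => ENNReal.ofReal_lt_top)]
  refine integral_congr_ae (ae_of_all _ fun x => ?_)
  simp only
  rw [ENNReal.toReal_ofReal (hg.nonneg x), smul_eq_mul, mul_comm]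

theorem ae_ne_of_map_eq_withDensity {Y : Ω → ℝ} (hY : Measurable Y) {g : ℝ → ℝ≥0∞}
    (hlaw : P.map Y = volume.withDensity g) (c : ℝ) : ∀ᵐ ω ∂P, Y ω ≠ c := by
  have h : ∀ᵐ x ∂(P.map Y), x ≠ c := by
    rw [hlaw]
    exact (withDensity_absolutelyContinuous _ _).ae_le (Measure.ae_ne volume c)
  exact ae_of_ae_map hY.aemeasurable h

/-- Lipschitz deviation bounds at a given rate give type 2 error bounds at the same rate. -/
theorem HasLipschitzDeviations.type2Error_bound [IsProbabilityMeasure P] {X : ℕ → Ω → ℝ}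
    {rate : ℕ → ℝ} (hdev : HasLipschitzDeviations P X rate) (hr : ∀ N, 0 ≤ rate N)
    (hC : UniformCramer P X) (hX : ∀ i, Measurable (X i)) {g : ℝ → ℝ} {H : ℝ}
    (hg : IsDensityWithMean g H)
    (hlaw : P.map (X 0) = volume.withDensity fun x => ENNReal.ofReal (g x))
    {κ K : ℝ} (hκ : 0 < κ) (hκK : κ < K) :
    ∃ L₁ : ℝ, 0 < L₁ ∧ ∃ L₂ : ℝ → ℝ, (∀ δ, 0 < δ → 0 < L₂ δ) ∧
      ∀ C δ : ℝ, 0 < C → C < maxLimitPsi g H κ K → δ = maxLimitPsi g H κ K - C →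
        ∀ N : ℕ, 1 ≤ N →
          P.real (type2Error X κ K C N) ≤ L₁ * Real.exp (-(L₂ δ * rate N)) := by
  have key : ∀ δ, ∃ c : ℝ, 0 < c ∧ (0 < δ → ∀ N, 1 ≤ N →
      P.real (type2Error X κ K (maxLimitPsi g H κ K - δ) N) ≤
        Real.exp 1 * Real.exp (-(c * rate N))) := by
    intro δ
    by_cases hδ : 0 < δ
    · have hlt : maxLimitPsi g H κ K - δ < maxLimitPsi g H κ K := by linarith
      obtain ⟨_, ⟨b, hb, rfl⟩, hbC⟩ :=
        exists_lt_of_lt_csSup ((Set.nonempty_Icc.2 hκK.le).image _) hlt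
      have hb0 : 0 < b := hκ.trans_le hb.1
      have hmean : ∫ ω, X 0 ω ∂P = H :=
        (integral_comp_eq_integral_mul (hX 0) hg hlaw measurable_id).trans hg.mean_eq
      have hcut : Measurable fun x => cutoff b (x - H) :=
        Measurable.ite (measurableSet_lt (measurable_id.sub_const H).abs measurable_const)
          (measurable_id.sub_const H) measurable_const
      have hE := hdev.expSmall_type2Error hr hC hX (ae_ne_of_map_eq_withDensity (hX 0) hlaw) hb hb0
        (C := maxLimitPsi g H κ K - δ) (by
          rw [hmean, integral_comp_eq_integral_mul (hX 0) hg hlaw hcut,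
            ← limitPsi_eq_integral_cutoff hg hb0.le]
          exact hbC)
      obtain ⟨c, hc, hcN⟩ := hE.exists_universal fun N => measureReal_le_one
      exact ⟨c, hc, fun _ => hcN⟩
    · exact ⟨1, one_pos, fun h => absurd h hδ⟩
  choose L₂ hL₂ hbd using key
  refine ⟨Real.exp 1, Real.exp_pos 1, L₂, fun δ _ => hL₂ δ, fun C δ _ hCM hδ N hN => ?_⟩
  have e : C = maxLimitPsi g H κ K - δ := by linarith
  rw [e]
  exact hbd δ (by linarith) N hN

end

end SwitchingMixture

theorem theorem4 {Ω : Type*} [MeasurableSpace Ω] (P : Measure Ω) [IsProbabilityMeasure P]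
    (X : ℕ → Ω → ℝ) (k : ℕ) (f₀ : ℝ → ℝ) (f : Fin k → ℝ → ℝ) (h ε : Fin k → ℝ)
    (hf₀ : SwitchingMixture.IsDensityWithMean f₀ 0)
    (hf : ∀ j, SwitchingMixture.IsDensityWithMean (f j) (h j))
    (hε : ∀ j, 0 ≤ ε j) (hε_sum : ∑ j, ε j < 1)
    (hX : ∀ i, Measurable (X i))
    (hlaw : ∀ i, P.map (X i) = volume.withDensity
      (fun x => ENNReal.ofReal (SwitchingMixture.mixtureDensity f₀ f ε x)))
    (hCramer : SwitchingMixture.UniformCramer P X)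
    (κ K : ℝ) (hκ : 0 < κ) (hκK : κ < K) :
    (SwitchingMixture.IsPsiMixing P X →
      ∃ L₁ : ℝ, 0 < L₁ ∧ ∃ L₂ : ℝ → ℝ, (∀ δ, 0 < δ → 0 < L₂ δ) ∧
        ∀ C δ : ℝ, 0 < C →
          C < SwitchingMixture.maxLimitPsi (SwitchingMixture.mixtureDensity f₀ f ε)
            (SwitchingMixture.mixtureMean ε h) κ K →
          δ = SwitchingMixture.maxLimitPsi (SwitchingMixture.mixtureDensity f₀ f ε)
            (SwitchingMixture.mixtureMean ε h) κ K - C →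
          ∀ N : ℕ, 1 ≤ N →
            P.real (SwitchingMixture.type2Error X κ K C N) ≤ L₁ * Real.exp (-(L₂ δ * N))) ∧
    (∀ L ψ θ, SwitchingMixture.IsAdmissible L ψ → SwitchingMixture.HasExpDecay θ →
      SwitchingMixture.IsWeaklyDependent P X L ψ θ →
      ∃ L₁ : ℝ, 0 < L₁ ∧ ∃ L₂ : ℝ → ℝ, (∀ δ, 0 < δ → 0 < L₂ δ) ∧
        ∀ C δ : ℝ, 0 < C →
          C < SwitchingMixture.maxLimitPsi (SwitchingMixture.mixtureDensity f₀ f ε)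
            (SwitchingMixture.mixtureMean ε h) κ K →
          δ = SwitchingMixture.maxLimitPsi (SwitchingMixture.mixtureDensity f₀ f ε)
            (SwitchingMixture.mixtureMean ε h) κ K - C →
          ∀ N : ℕ, 1 ≤ N →
            P.real (SwitchingMixture.type2Error X κ K C N)
              ≤ L₁ * Real.exp (-(L₂ δ * Real.sqrt N))) := by
  have hmix := SwitchingMixture.isDensityWithMean_mixture hf₀ hf hε hε_sum
  have hmap : ∀ i, P.map (X i) = P.map (X 0) := fun i => (hlaw i).trans (hlaw 0).symm
  refine ⟨fun hψ => ?_, fun L ψ θ hL hθ hweak => ?_⟩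
  · exact (hψ.hasLipschitzDeviations hCramer hX hmap).type2Error_bound (fun N => N.cast_nonneg)
      hCramer hX hmix (hlaw 0) hκ hκK
  · obtain ⟨B, a, p, hB, ha, hcov⟩ := hweak.hasCappedCovarianceDecay hL hθ
    exact (hcov.hasLipschitzDeviations hB ha hCramer hX hmap).type2Error_bound
      (fun N => Real.sqrt_nonneg N) hCramer hX hmix (hlaw 0) hκ hκK
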